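/- **Setting.** All distances are geodesic and are measured on the sphere $S^2$ of unit area. For each $n$, nodes $X_1,\dots,X_n$ are independent and uniformly distributed on $S^2$. Each node $i$ picks its destination $D_i$ uniformly among the other nodes, independently of the positions and of the other choices. Let $L_i$ be the distance from $X_i$ to $X_{D_i}$. Let $\rho_n>0$ be the radius of a disk of area $100\log n/n$ on $S^2$. Fix $\alpha>2$, an integer $K\ge 1$ and a function $\varphi$ on $[0,\infty)$, none of which depends on $n$. **A1.** $S^2$ is divided into the cells of a Voronoi tessellation with finitely many distinct, non-random sites. Each cell contains a disk of radius $\rho_n$ and lies in a disk of radius $2\rho_n$. All nodes transmit with the same power $P>0$. **A2.** A transmission received with SINR $s$ succeeds with probability $\varphi(s)$. Here $\varphi:[0,\infty)\to[0,1)$ is continuous and increasing, and $\varphi(s)\to1$ as $s\to\infty$. A transmission from node $a$ to node $b$ has $$\mathrm{SINR}=\frac{P\,|X_a-X_b|^{-\alpha}}{N+\sum_{k\in T,\,k\ne a}P\,|X_k-X_b|^{-\alpha}},$$ where $T$ is the set of nodes transmitting in the same slot and $N\ge 0$ is the noise power. Successes on different hops are independent, and lost packets are not retransmitted. **A3.**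 Time is slotted. The cells are served by a cyclic schedule of length at most $K$ that serves every cell at least once per cycle. In each slot, exactly one node of each scheduled cell transmits. **A4.** The packets of connection $i$ are relayed by exactly the cells that meet the shortest arc from $X_i$ to $X_{D_i}$, in the order in which the arc meets them, with one node of each cell acting as relay. If only one cell meets the arc, there is a single hop from source to destination. A3 and A4 are required only when every cell contains a node. In that case all sources also inject packets at a common long-run rate $\lambda_n$ (in packets per slot). A source injects a packet only in a slot in which it is the transmitting node of its cell. The throughput $\Lambda_n(i)$ of connection $i$ is $\lambda_n$ times the probability that a packet is received over all of its hops. If this probability varies from packet to packet, $\Lambda_n(i)$ is the long-run mean number of delivered packets per slot, taken as an upper limit. Let $\Lambda_n=\mathbf E[\Lambda_n(i)]$, the expectation being over the node positions and destinations. **Proposition.** There are constants $t_0\in(0,1)$, $M_0>9$ and $C$ depending only on $\alpha$, $K$ and $\varphi$ (in particular not on $n$) such that, with $$\beta_0=\Big(\frac{M_0+8}{t_0}\Big)^{\alpha},\qquad \varphi(\beta_0)>0,$$ the following holds for every $n$ and every network satisfying A1–A4. 1. Almost surely, if every cell contains a node, then every packet of every connection $i$ with $L_i\ge C\rho_n$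 has SINR less than $\beta_0$ on at least $L_i/(16\rho_n)$ of its hops. 2. For every connection, $$\Lambda_n\le\frac{c_0}{n},\qquad c_0=\frac{2^{12}}{(\log\varphi(\beta_0))^2}.$$ In particular the per-node throughput is $O(1/n)$, so it is not $\Theta(1/\sqrt{n\log n})$. -/

import Mathlib

open MeasureTheory ProbabilityTheory Filter Set
open scoped ENNReal Topology

noncomputable section

namespace AdHoc

/-! ### The sphere of unit area -/

/-- The sphere of unit area has radius `1 / (2 √π)`.  Its points are represented by their
outward unit normal vectors; lengths and areas below are those of the sphere of radius
`1 / (2 √π)`. -/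
abbrev S2 : Type := Metric.sphere (0 : EuclideanSpace ℝ (Fin 3)) 1

/-- Distance measured along the surface: radius times the angle at the centre. -/
def gdist (x y : S2) : ℝ :=
  1 / (2 * √Real.pi) *
    InnerProductGeometry.angle (x : EuclideanSpace ℝ (Fin 3)) (y : EuclideanSpace ℝ (Fin 3))

/-- Surface area: the square `1 / (4 π)` of the radius times the surface measure of the unit
sphere.  The total area is one, so this is also the uniform probability distribution. -/
def area : Measure S2 :=
  ENNReal.ofReal (1 / (4 * Real.pi)) • (volume : Measure (EuclideanSpace ℝ (Fin 3))).toSphere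

/-- The disk with centre `x` and radius `r`, measured along the surface. -/
def disk (x : S2) (r : ℝ) : Set S2 := {y | gdist x y ≤ r}

/-- The straight line (shortest arc along the surface) from `x` to `y`. -/
def line (x y : S2) : Set S2 := {z | gdist x z + gdist z y = gdist x y}

/-! ### Voronoi tessellations -/

/-- The Voronoi cell of the site `p c`. -/
def voronoiCell {m : ℕ} (p : Fin m → S2) (c : Fin m) : Set S2 :=
  {x | ∀ c', gdist x (p c) ≤ gdist x (p c')}

/-- The Voronoi tessellation with sites `p` is uniform at scale `ρ`: each cell contains a disk
of radius `ρ` and is contained in a disk of radius `2 ρ`. -/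
structure IsUniformTessellation {m : ℕ} (p : Fin m → S2) (ρ : ℝ) : Prop where
  injective : Function.Injective p
  contains_disk : ∀ c, ∃ x, disk x ρ ⊆ voronoiCell p c
  subset_disk : ∀ c, ∃ x, voronoiCell p c ⊆ disk x (2 * ρ)

/-! ### Random nodes and destinations -/

/-- The `n` nodes `X i` are independent and uniform on the sphere, and each node `i` picks its
destination `D i` independently and uniformly among the other nodes. -/
structure IsRandomNetwork {Ω : Type*} [MeasurableSpace Ω] (μ : Measure Ω) {n : ℕ}
    (X : Fin n → Ω → S2) (D : Fin n → Ω → Fin n) : Prop where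
  measurable_position : ∀ i, Measurable (X i)
  measurable_destination : ∀ i, Measurable (D i)
  law_position : ∀ i, μ.map (X i) = area
  law_destination : ∀ i j, j ≠ i → μ {ω | D i ω = j} = (((n - 1 : ℕ) : ℝ≥0∞))⁻¹
  indep_position : iIndepFun X μ
  indep_destination : iIndepFun D μ
  indep : IndepFun (fun ω i => X i ω) (fun ω i => D i ω) μ

/-! ### The link layer -/

/-- `φ` maps the SINR to the probability that a packet is received: continuous, increasing,
strictly below one at each finite SINR, and tending to one as the SINR tends to infinity. -/
structure IsSuccessCurve (φ : ℝ → ℝ) : Prop where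
  continuousOn : ContinuousOn φ (Ici 0)
  monotoneOn : MonotoneOn φ (Ici 0)
  nonneg : ∀ s, 0 ≤ s → 0 ≤ φ s
  lt_one : ∀ s, 0 ≤ s → φ s < 1
  tendsto_one : Tendsto φ atTop (𝓝 1)

/-- Success probability at an SINR that may be infinite. -/
def successProb (φ : ℝ → ℝ) (s : ℝ≥0∞) : ℝ≥0∞ :=
  if s = ∞ then 1 else ENNReal.ofReal (φ s.toReal)

/-- Power `P / d ^ α` received at `y` from a transmitter at `x`, where `d` is their distance
(infinite for `d = 0`). -/
def receivedPower (P α : ℝ) (x y : S2) : ℝ≥0∞ :=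
  ENNReal.ofReal P * ENNReal.ofReal (gdist x y) ^ (-α)

/-! ### Scheduling, routing and throughput for given positions and destinations -/

/-- What `n` nodes and `m` cells do in the time slots `0, 1, 2, …`.  A packet is identified by
its source `i` and the slot `t` in which the source injects (first transmits) it. -/
structure Operation (n m : ℕ) where
  /-- The cells that transmit in slot `t`. -/
  active : ℕ → Set (Fin m)
  /-- The node of the cell `c` that transmits in slot `t`, if `c` is active. -/
  transmitter : ℕ → Fin m → Fin n
  /-- The slots in which node `i` injects a new packet. -/
  injects : Fin n → Set ℕ
  /-- The number of hops of connection `i`. -/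
  hops : Fin n → ℕ
  /-- The cells `cell i 0, …, cell i (hops i)` visited by the packets of connection `i`. -/
  cell : Fin n → ℕ → Fin m
  /-- `relay i t j` is the node where packet `(i, t)` is after `j` hops. -/
  relay : Fin n → ℕ → ℕ → Fin n
  /-- `slot i t j` is the slot of the single transmission of packet `(i, t)` over its hop from
  `relay i t j` to `relay i t (j + 1)`. -/
  slot : Fin n → ℕ → ℕ → ℕ

namespace Operation

variable {n m : ℕ}

/-- Nodes that transmit in slot `t`. -/
def transmitting (op : Operation n m) (t : ℕ) : Set (Fin n) :=
  {k | ∃ c ∈ op.active t, op.transmitter t c = k}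

/-- A cyclic schedule of length at most `K` which serves each cell at least once per cycle.  In
each slot exactly one node transmits in each active cell. -/
structure IsSchedule (op : Operation n m) (K : ℕ) (p : Fin m → S2) (x : Fin n → S2) : Prop where
  periodic : ∃ k, 0 < k ∧ k ≤ K ∧ Function.Periodic op.active k
  serves : ∀ c, ∃ t, c ∈ op.active t
  transmitter_mem : ∀ t, ∀ c ∈ op.active t, x (op.transmitter t c) ∈ voronoiCell p c

/-- Straight-line routing for positions `x` and destinations `d`: the packets of connection `i`
visit exactly the cells that meet the line from `x i` to `x (d i)`, once each and in the order in
which the line meets them (the line leaves `cell i j` and enters `cell i (j + 1)` at `w (j + 1)`).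
If a single cell meets the line, the packet goes from source to destination in one hop inside
it. -/
structure IsStraightLine (op : Operation n m) (p : Fin m → S2) (x : Fin n → S2)
    (d : Fin n → Fin n) : Prop where
  hops_pos : ∀ i, 0 < op.hops i
  cells : ∀ i, op.cell i '' Iic (op.hops i) =
    {c | (voronoiCell p c ∩ line (x i) (x (d i))).Nonempty}
  once : ∀ i, InjOn (op.cell i) (Iic (op.hops i)) ∨ op.hops i = 1
  in_order : ∀ i, ∃ w : ℕ → S2,
    w 0 = x i ∧ w (op.hops i + 1) = x (d i) ∧
    (∀ j ≤ op.hops i + 1, w j ∈ line (x i) (x (d i))) ∧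
    (∀ j ≤ op.hops i, gdist (x i) (w j) ≤ gdist (x i) (w (j + 1))) ∧
    (∀ j ≤ op.hops i,
      w j ∈ voronoiCell p (op.cell i j) ∧ w (j + 1) ∈ voronoiCell p (op.cell i j))
  relay_zero : ∀ i, ∀ t ∈ op.injects i, op.relay i t 0 = i
  relay_last : ∀ i, ∀ t ∈ op.injects i, op.relay i t (op.hops i) = d i
  relay_mem : ∀ i, ∀ t ∈ op.injects i, ∀ j ≤ op.hops i,
    x (op.relay i t j) ∈ voronoiCell p (op.cell i j)

/-- Every packet is transmitted once over each of its hops, in successive slots that the schedule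
gives to the relaying cell; the first of these is the slot of injection. -/
structure IsForwarding (op : Operation n m) : Prop where
  slot_zero : ∀ i, ∀ t ∈ op.injects i, op.slot i t 0 = t
  slot_lt : ∀ i, ∀ t ∈ op.injects i, ∀ j, j + 1 < op.hops i → op.slot i t j < op.slot i t (j + 1)
  active : ∀ i, ∀ t ∈ op.injects i, ∀ j < op.hops i, op.cell i j ∈ op.active (op.slot i t j)
  transmitter : ∀ i, ∀ t ∈ op.injects i, ∀ j < op.hops i,
    op.transmitter (op.slot i t j) (op.cell i j) = op.relay i t j

open Classical in
/-- All source nodes inject packets at one and the same rate `r` (in packets per slot). -/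
def HasRate (op : Operation n m) (r : ℝ) : Prop :=
  ∀ i, Tendsto
    (fun T : ℕ => (((Finset.range T).filter (· ∈ op.injects i)).card : ℝ) / T) atTop (𝓝 r)

open Classical in
/-- The SINR at the receiver of hop `j` of the packet `(i, t)`, for transmit power `P`, noise
power `N`, path loss exponent `α` and positions `x`. -/
def sinr (op : Operation n m) (P N α : ℝ) (x : Fin n → S2) (i : Fin n) (t j : ℕ) : ℝ≥0∞ :=
  receivedPower P α (x (op.relay i t j)) (x (op.relay i t (j + 1))) /
    (ENNReal.ofReal N +
      ∑ k ∈ Finset.univ.filter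
          (fun k => k ∈ op.transmitting (op.slot i t j) ∧ k ≠ op.relay i t j),
        receivedPower P α (x k) (x (op.relay i t (j + 1))))

/-- The probability that the packet `(i, t)` is received over all the hops of connection `i`. -/
def deliveryProb (op : Operation n m) (φ : ℝ → ℝ) (P N α : ℝ) (x : Fin n → S2)
    (i : Fin n) (t : ℕ) : ℝ≥0∞ :=
  ∏ j ∈ Finset.range (op.hops i), successProb φ (op.sinr P N α x i t j)

open Classical in
/-- End-to-end throughput of connection `i`, in packets per slot: the long-run mean number per
slot of packets of `i` that reach the destination.  It is the injection rate times the delivery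
probability if the latter is the same for all the packets of `i`. -/
def throughput (op : Operation n m) (φ : ℝ → ℝ) (P N α : ℝ) (x : Fin n → S2)
    (i : Fin n) : ℝ≥0∞ :=
  limsup (fun T : ℕ =>
    (∑ t ∈ (Finset.range T).filter (· ∈ op.injects i), op.deliveryProb φ P N α x i t) /
      (T : ℝ≥0∞)) atTop

end Operation

end AdHoc

end

/-!
# Straight-line routing in random networks has throughput `O(1 / n)`

Along a long connection a positive fraction of the hops is bad, so that a packet survives with a
probability exponentially small in the length of the connection, while only short connections,
which are rare, escape this loss.

*Bad hops.*  By interference from distance `(M₀ + 8) ρ` a hop longer than `t₀ ρ` has SINR below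
`β₀ = ((M₀ + 8) / t₀) ^ α` (`Operation.sinr_lt`).  Hops have length at most `8 ρ` and their lengths
add up to at least `L`, and there are only `O(L / ρ)` hops by a packing argument
(`exists_packing_bound`, `Operation.card_cells_on_line_le`), so that for small `t₀` the hops of
length at most `t₀ ρ` contribute little to `L`.  Cut the line into stretches of length `M₀ ρ`.  Two
hops whose cells the line leaves in the same stretch, and which are served in the same slot of the
cycle, lead to mutual interference: whenever one of the cells transmits, so does the other.  At
most `K` hops per stretch have no such companion, and for `M₀ ≥ 64 K` they also contribute little.
The remaining long hops number at least `L / (16 ρ)` (`Operation.le_ncard_low_sinr`).  The argument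
uses two facts that hold almost surely: no node lies in two cells, and no destination is antipodal
to its source, so that the shortest arc is unique.

*Throughput.*  Each cell injects at most one packet per slot, so that the common rate is at most
`m / n` for `m` cells (`Operation.mul_rate_le`), and `m a ≤ 1` for the area `a` of a disk of radius
`ρ`.  Since the area of a disk grows at most quadratically with the radius
(`area_disk_le_mul`, from the exact area of a spherical cap), the expectation of
`φ β₀ ^ (L / (16 ρ))` over the connections with `L ≥ C ρ` is at most `2560 a / (log φ β₀) ^ 2`
(`lintegral_exp_neg_mul_le`), and connections with `L ≤ C ρ` have probability at most `5 C ^ 2 a`.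
Some cell is empty with probability at most `1 / n`.  As `C` depends on `K` only, `M₀` can be
chosen so large, and hence `φ β₀` so close to one, that the terms without the factor
`1 / (log φ β₀) ^ 2` are absorbed by the constant `2 ^ 12` (`exists_success_near_one`,
`lintegral_throughput_le`).
-/

namespace AdHoc

/-! ### Distances on the sphere -/

lemma norm_coe (x : S2) : ‖(x : EuclideanSpace ℝ (Fin 3))‖ = 1 := by
  simp

lemma coe_ne_zero (x : S2) : (x : EuclideanSpace ℝ (Fin 3)) ≠ 0 := by
  intro h
  simpa [h] using norm_coe x

lemma angle_eq_gdist (x y : S2) :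
    InnerProductGeometry.angle (x : EuclideanSpace ℝ (Fin 3)) (y : EuclideanSpace ℝ (Fin 3)) =
      2 * √Real.pi * gdist x y := by
  have : 0 < √Real.pi := Real.sqrt_pos.2 Real.pi_pos
  unfold gdist
  field_simp

lemma gdist_nonneg (x y : S2) : 0 ≤ gdist x y := by
  unfold gdist
  have := InnerProductGeometry.angle_nonneg (x : EuclideanSpace ℝ (Fin 3)) y
  positivity

lemma gdist_comm (x y : S2) : gdist x y = gdist y x := by
  unfold gdist
  rw [InnerProductGeometry.angle_comm]

lemma gdist_triangle (x y z : S2) : gdist x z ≤ gdist x y + gdist y z := by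
  unfold gdist
  rw [← mul_add]
  gcongr
  exact InnerProductGeometry.angle_le_angle_add_angle _ _ _

lemma gdist_self (x : S2) : gdist x x = 0 := by
  unfold gdist
  rw [InnerProductGeometry.angle_self (coe_ne_zero x), mul_zero]

lemma inner_eq_cos_gdist (x y : S2) :
    inner ℝ (x : EuclideanSpace ℝ (Fin 3)) y = Real.cos (2 * √Real.pi * gdist x y) := by
  rw [← angle_eq_gdist,
    InnerProductGeometry.inner_eq_cos_angle_of_norm_eq_one (norm_coe x) (norm_coe y)]

lemma _root_.Continuous.gdist {Y : Type*} [TopologicalSpace Y] {f g : Y → S2}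
    (hf : Continuous f) (hg : Continuous g) : Continuous fun y => gdist (f y) (g y) := by
  have heq : (fun y => AdHoc.gdist (f y) (g y)) = fun y => 1 / (2 * √Real.pi) *
      Real.arccos (inner ℝ (f y : EuclideanSpace ℝ (Fin 3)) (g y)) := by
    funext y
    simp only [AdHoc.gdist, InnerProductGeometry.angle, norm_coe, mul_one, div_one]
  rw [heq]
  exact continuous_const.mul (Real.continuous_arccos.comp
    ((continuous_subtype_val.comp hf).inner (continuous_subtype_val.comp hg)))

lemma isClosed_disk (x : S2) (r : ℝ) : IsClosed (disk x r) :=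
  isClosed_le (continuous_const.gdist continuous_id) continuous_const

lemma isClosed_voronoiCell {m : ℕ} (p : Fin m → S2) (c : Fin m) :
    IsClosed (voronoiCell p c) := by
  simp only [voronoiCell, ofPred_forall]
  exact isClosed_iInter fun c' =>
    isClosed_le (continuous_id.gdist continuous_const) (continuous_id.gdist continuous_const)

/-- Between points that are not antipodal the shortest arc is unique, so that points on it are as
far from each other as their distances from its starting point differ. -/
lemma gdist_eq_abs_sub_of_mem_line {x y z w : S2}
    (hxy : (y : EuclideanSpace ℝ (Fin 3)) ≠ -x) (hz : z ∈ line x y) (hw : w ∈ line x y) :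
    gdist z w = |gdist x z - gdist x w| := by
  have hpi : InnerProductGeometry.angle (x : EuclideanSpace ℝ (Fin 3)) y ≠ Real.pi := by
    intro h
    apply hxy
    have h1 : inner ℝ (x : EuclideanSpace ℝ (Fin 3)) y = -1 := by
      rw [InnerProductGeometry.inner_eq_cos_angle_of_norm_eq_one (norm_coe x) (norm_coe y), h,
        Real.cos_pi]
    rw [inner_eq_neg_one_iff_of_norm_eq_one (norm_coe x) (norm_coe y)] at h1
    rw [h1, neg_neg]
  have key : ∀ v : S2, v ∈ line x y →
      (v : EuclideanSpace ℝ (Fin 3)) ∈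
        Submodule.span NNReal {(x : EuclideanSpace ℝ (Fin 3)), ↑y} := by
    intro v hv
    refine ((InnerProductGeometry.angle_eq_angle_add_angle_iff (coe_ne_zero v)).1 ?_).resolve_left
      hpi
    rw [angle_eq_gdist, angle_eq_gdist, angle_eq_gdist, ← mul_add,
      show gdist x v + gdist v y = _ from hv]
  -- of two points in the cone spanned by `x` and `y`, one lies in the cone spanned by `x` and
  -- the other point
  have main : ∀ v v' : S2, ∀ a b a' b' : NNReal,
      (a • (x : EuclideanSpace ℝ (Fin 3)) + b • (y : EuclideanSpace ℝ (Fin 3)) = v) →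
      (a' • (x : EuclideanSpace ℝ (Fin 3)) + b' • (y : EuclideanSpace ℝ (Fin 3)) = v') →
      a' * b ≤ a * b' → gdist x v' = gdist x v + gdist v v' := by
    intro v v' a b a' b' hv hv' hle
    have hsp : (v : EuclideanSpace ℝ (Fin 3)) ∈
        Submodule.span NNReal {(x : EuclideanSpace ℝ (Fin 3)), ↑v'} := by
      rw [Submodule.mem_span_pair]
      rcases eq_or_ne b' 0 with hb | hb
      · have ha : a' ≠ 0 := by
          rintro rfl
          apply coe_ne_zero v'
          rw [← hv', hb]
          simp
        have hb0 : b = 0 := by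
          have : a' * b = 0 := le_antisymm (by simpa [hb] using hle) zero_le
          exact (mul_eq_zero.1 this).resolve_left ha
        exact ⟨a, 0, by rw [← hv, hb0]; simp⟩
      · refine ⟨(a * b' - a' * b) / b', b / b', ?_⟩
        rw [← hv, ← hv', smul_add, smul_smul, smul_smul, ← add_assoc, ← add_smul]
        congr 2
        · rw [div_mul_eq_mul_div, ← add_div, mul_comm b a', tsub_add_cancel_of_le hle]
          field_simp
        · field_simp
    have := (InnerProductGeometry.angle_eq_angle_add_angle_iff (x := (x : EuclideanSpace ℝ (Fin 3)))
      (coe_ne_zero v)).2 (Or.inr hsp)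
    unfold gdist
    rw [this]
    ring
  obtain ⟨a, b, hab⟩ := Submodule.mem_span_pair.1 (key z hz)
  obtain ⟨a', b', hab'⟩ := Submodule.mem_span_pair.1 (key w hw)
  rcases le_total (a' * b) (a * b') with h | h
  · have := main z w a b a' b' hab hab' h
    rw [this, sub_add_cancel_left, abs_neg, abs_of_nonneg (gdist_nonneg _ _)]
  · have := main w z a' b' a b hab' hab h
    rw [this, add_sub_cancel_left, abs_of_nonneg (gdist_nonneg _ _), gdist_comm]

/-! ### Packing -/

/-- Comparison of distances on the sphere of unit area with chords of the unit sphere. -/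
lemma norm_sub_bounds (x y : S2) :
    gdist x y ≤ ‖(x : EuclideanSpace ℝ (Fin 3)) - y‖ ∧
    ‖(x : EuclideanSpace ℝ (Fin 3)) - y‖ ≤ 4 * gdist x y := by
  have hsq : ‖(x : EuclideanSpace ℝ (Fin 3)) - y‖ ^ 2 =
      2 - 2 * Real.cos (2 * √Real.pi * gdist x y) := by
    rw [norm_sub_sq_real, norm_coe, norm_coe, inner_eq_cos_gdist]
    ring
  have h0 := gdist_nonneg x y
  have hpi : |2 * √Real.pi * gdist x y| ≤ Real.pi := by
    rw [abs_of_nonneg (by positivity), ← angle_eq_gdist]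
    exact InnerProductGeometry.angle_le_pi _ _
  have h1 := Real.cos_le_one_sub_mul_cos_sq hpi
  have h2 := Real.one_sub_sq_div_two_le_cos (x := 2 * √Real.pi * gdist x y)
  have hs : √Real.pi ^ 2 = Real.pi := Real.sq_sqrt Real.pi_pos.le
  constructor
  · refine (abs_le_of_sq_le_sq' ?_ (norm_nonneg _)).2
    have h3 : 2 / Real.pi ^ 2 * (2 * √Real.pi * gdist x y) ^ 2 = 8 / Real.pi * gdist x y ^ 2 := by
      rw [mul_pow, mul_pow, hs]
      field_simp
      ring
    have h4 : 1 ≤ 8 / Real.pi := by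
      rw [le_div_iff₀ Real.pi_pos]
      linarith [Real.pi_le_four]
    nlinarith [sq_nonneg (gdist x y)]
  · refine (abs_le_of_sq_le_sq' ?_ (by positivity)).2
    rw [mul_pow, mul_pow, hs] at h2
    nlinarith [sq_nonneg (gdist x y), Real.pi_le_four]

/-- At every scale `ρ`, at most `N₁` points at mutual distances of at least `ρ` fit into a set of
diameter `9 ρ`.  The points are indexed, as they arise as centres of disks in cells. -/
def IsPackingBound (N₁ : ℕ) : Prop :=
  ∀ (ρ : ℝ) (ι : Type) (S : Finset ι) (f : ι → S2), 0 < ρ →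
    (∀ a ∈ S, ∀ b ∈ S, a ≠ b → ρ ≤ gdist (f a) (f b)) →
    (∀ a ∈ S, ∀ b ∈ S, gdist (f a) (f b) ≤ 9 * ρ) → S.card ≤ N₁

/-- After scaling by `1 / ρ` the points lie in a fixed ball of the ambient space, which is covered
by finitely many balls that are too small to contain two of them. -/
lemma exists_packing_bound : ∃ N₁ : ℕ, 0 < N₁ ∧ IsPackingBound N₁ := by
  obtain ⟨t, -, htfin, hcov⟩ := finite_cover_balls_of_compact
    (isCompact_closedBall (0 : EuclideanSpace ℝ (Fin 3)) 36) (show (0 : ℝ) < 1 / 2 by norm_num)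
  refine ⟨htfin.toFinset.card + 1, by omega, fun ρ ι S f hρ hsep hdiam => ?_⟩
  rcases S.eq_empty_or_nonempty with rfl | ⟨a₀, ha₀⟩
  · simp
  set g : ι → EuclideanSpace ℝ (Fin 3) := fun a => ρ⁻¹ • ((f a : EuclideanSpace ℝ (Fin 3)) - f a₀)
  have hg : ∀ a ∈ S, ∃ b ∈ t, g a ∈ Metric.ball b (1 / 2) := by
    intro a ha
    have : g a ∈ Metric.closedBall (0 : EuclideanSpace ℝ (Fin 3)) 36 := by
      rw [mem_closedBall_zero_iff, norm_smul, Real.norm_of_nonneg (by positivity),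
        inv_mul_le_iff₀ hρ]
      linarith [(norm_sub_bounds (f a) (f a₀)).2, hdiam a ha a₀ ha₀]
    simpa using hcov this
  choose! h hht hhb using hg
  refine (Finset.card_le_card_of_injOn h (t := htfin.toFinset)
    (fun a ha => by simpa using hht a ha) ?_).trans (Nat.le_succ _)
  intro a ha b hb hab
  by_contra hne
  have h1 := hhb a ha
  have h2 := hhb b hb
  rw [← hab] at h2
  have h3 : dist (g a) (g b) < 1 := by
    calc dist (g a) (g b) ≤ dist (g a) (h a) + dist (g b) (h a) := dist_triangle_right _ _ _
      _ < 1 / 2 + 1 / 2 := add_lt_add h1 h2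
      _ = 1 := by norm_num
  have h4 : dist (g a) (g b) = ρ⁻¹ * ‖(f a : EuclideanSpace ℝ (Fin 3)) - f b‖ := by
    rw [dist_eq_norm, ← smul_sub, sub_sub_sub_cancel_right, norm_smul,
      Real.norm_of_nonneg (by positivity)]
  rw [h4, inv_mul_lt_iff₀ hρ, mul_one] at h3
  linarith [hsep a ha b hb hne, (norm_sub_bounds (f a) (f b)).1]

/-! ### Areas of disks and great circles -/

/-- Cylindrical coordinates with axis `x`: the height along `x` and the component orthogonal to
`x` are volume preserving coordinates. -/
lemma exists_cylindrical_coordinates (x : S2) :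
    ∃ F : EuclideanSpace ℝ (Fin 3) → ℝ × EuclideanSpace ℝ (Fin 2),
      MeasurePreserving F volume volume ∧
      ∀ y, (F y).1 = inner ℝ (x : EuclideanSpace ℝ (Fin 3)) y ∧
        ‖y‖ ^ 2 = (F y).1 ^ 2 + ‖(F y).2‖ ^ 2 := by
  have hv : Orthonormal ℝ (({0} : Set (Fin 3)).domRestrict
      (fun _ => (x : EuclideanSpace ℝ (Fin 3)))) := by
    refine ⟨fun i => norm_coe x, fun i j hij => (hij (Subsingleton.elim i j)).elim⟩
  obtain ⟨b, hb⟩ := hv.exists_orthonormalBasis_extension_of_card_eq (by simp)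
  have hb0 : b 0 = x := hb 0 rfl
  refine ⟨_, ((MeasurePreserving.id volume).prod (PiLp.volume_preserving_toLp (Fin 2))).comp
    ((volume_preserving_piFinSuccAbove (fun _ : Fin 3 => ℝ) 0).comp
      ((PiLp.volume_preserving_ofLp (Fin 3)).comp b.measurePreserving_repr)), fun y => ⟨?_, ?_⟩⟩
  · rw [← hb0, ← b.repr_apply_apply]
    rfl
  · rw [← b.repr.norm_map y, EuclideanSpace.norm_sq_eq, EuclideanSpace.norm_sq_eq,
      Fin.sum_univ_succ, Real.norm_eq_abs, sq_abs]
    rfl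

open scoped Pointwise in
lemma area_apply {s : Set S2} (hs : MeasurableSet s) :
    area s = ENNReal.ofReal (3 / (4 * Real.pi)) *
      volume (Ioo (0 : ℝ) 1 • ((↑) '' s : Set (EuclideanSpace ℝ (Fin 3)))) := by
  have h3 : ENNReal.ofReal (3 / (4 * Real.pi)) = ENNReal.ofReal (1 / (4 * Real.pi)) * 3 := by
    rw [← ENNReal.ofReal_ofNat 3, ← ENNReal.ofReal_mul (by positivity)]
    congr 1
    ring
  rw [area, Measure.smul_apply, Measure.toSphere_apply' _ hs, finrank_euclideanSpace_fin,
    smul_eq_mul, h3, mul_assoc]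
  rfl

lemma area_univ : area univ = 1 := by
  rw [area, Measure.smul_apply, Measure.toSphere_apply_univ, finrank_euclideanSpace_fin,
    EuclideanSpace.volume_ball_fin_three, smul_eq_mul]
  rw [ENNReal.ofReal_one, one_pow, one_mul, show ((3 : ℕ) : ℝ≥0∞) = ENNReal.ofReal 3 by simp,
    ← ENNReal.ofReal_mul (by norm_num), ← ENNReal.ofReal_mul (by positivity)]
  rw [ENNReal.ofReal_eq_one]
  have := Real.pi_pos
  field_simp

instance : IsProbabilityMeasure area := ⟨area_univ⟩

lemma area_pos_of_isOpen {U : Set S2} (hU : IsOpen U) (hne : U.Nonempty) : 0 < area U := by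
  rw [area, Measure.smul_apply, smul_eq_mul]
  refine ENNReal.mul_pos ?_ (hU.measure_ne_zero _ hne)
  simp [Real.pi_pos]

/-- Great circles have area zero. -/
lemma area_orthogonal {v : EuclideanSpace ℝ (Fin 3)} (hv : v ≠ 0) :
    area {x : S2 | inner ℝ v (x : EuclideanSpace ℝ (Fin 3)) = 0} = 0 := by
  rw [area_apply (isClosed_eq (continuous_const.inner continuous_subtype_val)
    continuous_const).measurableSet]
  have : volume ((ℝ ∙ v)ᗮ : Set (EuclideanSpace ℝ (Fin 3))) = 0 := by
    refine Measure.addHaar_submodule _ _ fun h => hv ?_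
    rw [Submodule.orthogonal_eq_top_iff] at h
    simpa using h
  rw [measure_mono_null ?_ this, mul_zero]
  rintro _ ⟨r, -, _, ⟨x, hx, rfl⟩, rfl⟩
  simp only [SetLike.mem_coe, Submodule.mem_orthogonal_singleton_iff_inner_right]
  rw [inner_smul_right, show inner ℝ v (x : EuclideanSpace ℝ (Fin 3)) = 0 from hx, mul_zero]

lemma lintegral_Ioc_polynomial {f F : ℝ → ℝ} {a b : ℝ} (hab : a ≤ b)
    (hF : ∀ x, HasDerivAt F (f x) x) (hf : Continuous f) (h0 : ∀ x ∈ Ioc a b, 0 ≤ f x) :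
    ∫⁻ x in Ioc a b, ENNReal.ofReal (f x) = ENNReal.ofReal (F b - F a) := by
  rw [← ofReal_integral_eq_lintegral_ofReal, ← intervalIntegral.integral_of_le hab,
    intervalIntegral.integral_eq_sub_of_hasDerivAt (fun x _ => hF x) (hf.intervalIntegrable _ _)]
  · exact (hf.intervalIntegrable a b).1
  · exact (ae_restrict_iff' measurableSet_Ioc).2 (ae_of_all _ h0)

/-- The volume of the part of the unit ball where the angle with `x` has cosine at least `c`. -/
lemma volume_cone (x : S2) {c : ℝ} (hc0 : 0 ≤ c) (hc1 : c ≤ 1) :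
    volume {y : EuclideanSpace ℝ (Fin 3) | ‖y‖ < 1 ∧
      c * ‖y‖ ≤ inner ℝ (x : EuclideanSpace ℝ (Fin 3)) y} =
      ENNReal.ofReal (2 * Real.pi / 3 * (1 - c)) := by
  obtain ⟨F, hF, hFy⟩ := exists_cylindrical_coordinates x
  set S : Set (ℝ × EuclideanSpace ℝ (Fin 2)) :=
    {q | q.1 ^ 2 + ‖q.2‖ ^ 2 < 1 ∧ c * √(q.1 ^ 2 + ‖q.2‖ ^ 2) ≤ q.1} with hS
  have hSm : MeasurableSet S := by
    exact (isOpen_lt (f := fun q : ℝ × EuclideanSpace ℝ (Fin 2) => q.1 ^ 2 + ‖q.2‖ ^ 2)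
      (by fun_prop) continuous_const).measurableSet.inter (isClosed_le
        (f := fun q : ℝ × EuclideanSpace ℝ (Fin 2) => c * √(q.1 ^ 2 + ‖q.2‖ ^ 2)) (by fun_prop)
        continuous_fst).measurableSet
  have hpre : {y : EuclideanSpace ℝ (Fin 3) | ‖y‖ < 1 ∧
      c * ‖y‖ ≤ inner ℝ (x : EuclideanSpace ℝ (Fin 3)) y} = F ⁻¹' S := by
    ext y
    simp only [hS, mem_preimage, Set.mem_ofPred_eq, ← (hFy y).2, ← (hFy y).1,
      Real.sqrt_sq (norm_nonneg y)]
    rw [sq_lt_one_iff₀ (norm_nonneg y)]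
  rw [hpre, hF.measure_preimage hSm.nullMeasurableSet, Measure.volume_eq_prod,
    Measure.prod_apply hSm]
  -- slices at heights in `(0, c)` are bounded by the cone, those in `(c, 1)` by the sphere;
  -- for `c = 0` the first range is empty and the division by `c` does no harm
  have hlow : ∀ h ∈ Ioo 0 c, volume (Prod.mk h ⁻¹' S) =
      ENNReal.ofReal (Real.pi * ((1 - c ^ 2) / c ^ 2) * h ^ 2) := by
    rintro h ⟨h0, hc⟩
    have hcpos : 0 < c := h0.trans hc
    have h1c : 0 ≤ 1 - c ^ 2 := by nlinarith
    have : Prod.mk h ⁻¹' S = Metric.closedBall 0 (√(1 - c ^ 2) / c * h) := by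
      ext v
      have hv := norm_nonneg v
      simp only [hS, mem_preimage, Set.mem_ofPred_eq, mem_closedBall_zero_iff]
      have e1 : c * √(h ^ 2 + ‖v‖ ^ 2) ≤ h ↔ c ^ 2 * (h ^ 2 + ‖v‖ ^ 2) ≤ h ^ 2 := by
        rw [← pow_le_pow_iff_left₀ (by positivity) h0.le two_ne_zero, mul_pow,
          Real.sq_sqrt (by positivity)]
      have e2 : ‖v‖ ≤ √(1 - c ^ 2) / c * h ↔ c ^ 2 * ‖v‖ ^ 2 ≤ (1 - c ^ 2) * h ^ 2 := by
        rw [← pow_le_pow_iff_left₀ hv (by positivity) two_ne_zero, mul_pow, div_pow,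
          Real.sq_sqrt h1c, div_mul_eq_mul_div, le_div_iff₀ (by positivity), mul_comm]
      rw [e1, e2]
      constructor
      · rintro ⟨-, h2⟩
        nlinarith
      · intro h2
        refine ⟨?_, by nlinarith⟩
        have : c ^ 2 * (h ^ 2 + ‖v‖ ^ 2) < c ^ 2 * 1 := by nlinarith
        exact lt_of_mul_lt_mul_left this (by positivity)
    rw [this, EuclideanSpace.volume_closedBall_fin_two, ← ENNReal.ofReal_pow (by positivity),
      ← ENNReal.ofReal_mul (by positivity), mul_pow, div_pow, Real.sq_sqrt h1c]
    congr 1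
    ring
  have hhigh : ∀ h ∈ Ioo c 1, volume (Prod.mk h ⁻¹' S) =
      ENNReal.ofReal (Real.pi * (1 - h ^ 2)) := by
    rintro h ⟨hc, h1⟩
    have h0 : 0 < h := hc0.trans_lt hc
    have h1h : 0 ≤ 1 - h ^ 2 := by nlinarith
    have : Prod.mk h ⁻¹' S = Metric.ball 0 (√(1 - h ^ 2)) := by
      ext v
      have hv := norm_nonneg v
      simp only [hS, mem_preimage, Set.mem_ofPred_eq, mem_ball_zero_iff]
      rw [Real.lt_sqrt hv]
      constructor
      · rintro ⟨h2, -⟩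
        linarith
      · intro h2
        refine ⟨by linarith, ?_⟩
        have : √(h ^ 2 + ‖v‖ ^ 2) ≤ 1 := Real.sqrt_le_one.2 (by linarith)
        nlinarith
    rw [this, EuclideanSpace.volume_ball_fin_two, ← ENNReal.ofReal_pow (by positivity),
      ← ENNReal.ofReal_mul (by positivity), Real.sq_sqrt h1h, mul_comm]
  have hout : ∀ h, h < 0 ∨ 1 < h → volume (Prod.mk h ⁻¹' S) = 0 := by
    intro h hh
    have : Prod.mk h ⁻¹' S = ∅ := by
      ext v
      simp only [hS, mem_preimage, Set.mem_ofPred_eq, mem_empty_iff_false, iff_false, not_and,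
        not_le]
      intro h1
      rcases hh with hh | hh
      · exact hh.trans_le (by positivity)
      · nlinarith [norm_nonneg v]
    rw [this, measure_empty]
  have hsplit : ∫⁻ h, volume (Prod.mk h ⁻¹' S) = ∫⁻ h,
      ((Ioc 0 c).indicator (fun h => ENNReal.ofReal (Real.pi * ((1 - c ^ 2) / c ^ 2) * h ^ 2)) h +
        (Ioc c 1).indicator (fun h => ENNReal.ofReal (Real.pi * (1 - h ^ 2))) h) := by
    refine lintegral_congr_ae ?_
    filter_upwards [Measure.ae_ne volume 0, Measure.ae_ne volume c, Measure.ae_ne volume (1 : ℝ)]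
      with h n0 nc n1
    rcases lt_or_gt_of_ne n0 with g0 | g0
    · rw [hout h (Or.inl g0), indicator_of_notMem, indicator_of_notMem, add_zero]
      · exact fun hh => by linarith [hh.1]
      · exact fun hh => by linarith [hh.1]
    rcases lt_or_gt_of_ne nc with gc | gc
    · rw [hlow h ⟨g0, gc⟩, indicator_of_mem (s := Ioc 0 c) ⟨g0, gc.le⟩, indicator_of_notMem,
        add_zero]
      exact fun hh => by linarith [hh.1]
    rcases lt_or_gt_of_ne n1 with g1 | g1
    · rw [hhigh h ⟨gc, g1⟩, indicator_of_mem (s := Ioc c 1) ⟨gc, g1.le⟩, indicator_of_notMem,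
        zero_add]
      exact fun hh => by linarith [hh.2]
    · rw [hout h (Or.inr g1), indicator_of_notMem, indicator_of_notMem, add_zero]
      · exact fun hh => by linarith [hh.2]
      · exact fun hh => by linarith [hh.2]
  rw [hsplit, lintegral_add_left (by
      refine Measurable.indicator ?_ measurableSet_Ioc
      fun_prop), lintegral_indicator measurableSet_Ioc,
    lintegral_indicator measurableSet_Ioc,
    lintegral_Ioc_polynomial (F := fun h => Real.pi * ((1 - c ^ 2) / c ^ 2) * (h ^ 3 / 3)) hc0
      (fun h => by
        have := ((hasDerivAt_pow 3 h).div_const 3).const_mul (Real.pi * ((1 - c ^ 2) / c ^ 2))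
        refine this.congr_deriv ?_
        norm_num) (by fun_prop) ?_,
    lintegral_Ioc_polynomial (F := fun h => Real.pi * (h - h ^ 3 / 3)) hc1
      (fun h => by
        have := ((hasDerivAt_id h).sub ((hasDerivAt_pow 3 h).div_const 3)).const_mul Real.pi
        refine this.congr_deriv ?_
        norm_num) (by fun_prop) ?_, ← ENNReal.ofReal_add]
  · congr 1
    rcases hc0.eq_or_lt with rfl | hcpos
    · norm_num
      ring
    · field_simp
      ring
  · have : 0 ≤ 1 - c ^ 2 := by nlinarith
    have hpi := Real.pi_pos
    norm_num
    positivity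
  · have : 0 ≤ (1 - c) ^ 2 * (c + 2) := by positivity
    rw [← mul_sub]
    exact mul_nonneg Real.pi_pos.le (by nlinarith)
  · rintro h ⟨h0, h1⟩
    have : 0 ≤ 1 - h ^ 2 := by nlinarith
    have hpi := Real.pi_pos
    positivity
  · rintro h -
    have : 0 ≤ 1 - c ^ 2 := by nlinarith
    have hpi := Real.pi_pos
    positivity

lemma sqrt_pi_sq : √Real.pi * √Real.pi = Real.pi := Real.mul_self_sqrt Real.pi_pos.le

lemma gdist_le_iff {x y : S2} {r : ℝ} (h0 : 0 ≤ r) (h1 : 2 * √Real.pi * r ≤ Real.pi) :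
    gdist x y ≤ r ↔
      Real.cos (2 * √Real.pi * r) ≤ inner ℝ (x : EuclideanSpace ℝ (Fin 3)) y := by
  have hs : 0 < √Real.pi := Real.sqrt_pos.2 Real.pi_pos
  have h2 : 2 * √Real.pi * gdist x y ≤ Real.pi := by
    rw [← angle_eq_gdist]
    exact InnerProductGeometry.angle_le_pi _ _
  have h3 := gdist_nonneg x y
  rw [inner_eq_cos_gdist, Real.strictAntiOn_cos.le_iff_ge ⟨by positivity, h1⟩
    ⟨by positivity, h2⟩, mul_le_mul_iff_right₀ (by positivity)]

open scoped Pointwise in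
/-- The area of a disk that is at most a hemisphere. -/
lemma area_disk (x : S2) {r : ℝ} (h0 : 0 ≤ r) (h1 : r ≤ √Real.pi / 4) :
    area (disk x r) = ENNReal.ofReal ((1 - Real.cos (2 * √Real.pi * r)) / 2) := by
  have hs : 0 < √Real.pi := Real.sqrt_pos.2 Real.pi_pos
  have hr : 2 * √Real.pi * r ≤ Real.pi / 2 := by nlinarith [sqrt_pi_sq]
  have hc0 : 0 ≤ Real.cos (2 * √Real.pi * r) :=
    Real.cos_nonneg_of_neg_pi_div_two_le_of_le
      (by nlinarith [Real.pi_pos, mul_nonneg hs.le h0]) hr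
  have hset : (Ioo (0 : ℝ) 1 • ((↑) '' disk x r : Set (EuclideanSpace ℝ (Fin 3)))) =
      {y | ‖y‖ < 1 ∧ Real.cos (2 * √Real.pi * r) * ‖y‖ ≤
        inner ℝ (x : EuclideanSpace ℝ (Fin 3)) y} \ {0} := by
    ext y
    constructor
    · rintro ⟨t, ⟨ht0, ht1⟩, _, ⟨z, hz, rfl⟩, rfl⟩
      have hz' : gdist x z ≤ r := hz
      rw [gdist_le_iff h0 (by linarith [Real.pi_pos])] at hz'
      refine ⟨⟨?_, ?_⟩, ?_⟩
      · simpa [norm_smul, abs_of_pos ht0] using ht1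
      · simp only [norm_smul, norm_coe, inner_smul_right, Real.norm_of_nonneg ht0.le]
        nlinarith
      · simpa [ht0.ne'] using coe_ne_zero z
    · rintro ⟨⟨hy1, hy⟩, hy0⟩
      have hn : 0 < ‖y‖ := norm_pos_iff.2 hy0
      refine ⟨‖y‖, ⟨hn, hy1⟩, ‖y‖⁻¹ • y, ⟨⟨‖y‖⁻¹ • y, ?_⟩, ?_, rfl⟩, ?_⟩
      · simp [norm_smul, hn.ne']
      · change gdist x _ ≤ r
        rw [gdist_le_iff h0 (by linarith [Real.pi_pos])]
        simp only [inner_smul_right]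
        rwa [le_inv_mul_iff₀ hn, mul_comm]
      · simp [smul_smul, hn.ne']
  rw [area_apply (isClosed_disk x r).measurableSet, hset,
    measure_sdiff_null (measure_singleton _), volume_cone x hc0 (Real.cos_le_one _),
    ← ENNReal.ofReal_mul (by positivity)]
  congr 1
  have := Real.pi_pos
  field_simp
  ring

lemma area_disk_le (x : S2) {r : ℝ} (h0 : 0 ≤ r) :
    area (disk x r) ≤ ENNReal.ofReal (2 * Real.pi * r ^ 2) := by
  rcases le_total r (√Real.pi / 4) with h1 | h1
  · rw [area_disk x h0 h1]
    refine ENNReal.ofReal_le_ofReal ?_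
    have := Real.one_sub_sq_div_two_le_cos (x := 2 * √Real.pi * r)
    have e : (2 * √Real.pi * r) ^ 2 = 4 * Real.pi * r ^ 2 := by
      rw [mul_pow, mul_pow, Real.sq_sqrt Real.pi_pos.le]
      ring
    nlinarith [mul_nonneg Real.pi_pos.le (sq_nonneg r)]
  · refine prob_le_one.trans ?_
    rw [ENNReal.one_le_ofReal]
    have : Real.pi / 16 ≤ r ^ 2 := by
      have := pow_le_pow_left₀ (by positivity) h1 2
      rw [div_pow, Real.sq_sqrt Real.pi_pos.le] at this
      linarith
    nlinarith [Real.pi_gt_three]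

lemma le_area_disk (x : S2) {r : ℝ} (h0 : 0 ≤ r) (h1 : r ≤ √Real.pi / 4) :
    ENNReal.ofReal (4 / Real.pi * r ^ 2) ≤ area (disk x r) := by
  rw [area_disk x h0 h1]
  refine ENNReal.ofReal_le_ofReal ?_
  have hs : 0 < √Real.pi := Real.sqrt_pos.2 Real.pi_pos
  have hr : 2 * √Real.pi * r ≤ Real.pi / 2 := by nlinarith [sqrt_pi_sq]
  have := Real.cos_le_one_sub_mul_cos_sq (x := 2 * √Real.pi * r)
    (by rw [abs_of_nonneg (by positivity)]; linarith [Real.pi_pos])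
  have e : 2 / Real.pi ^ 2 * (2 * √Real.pi * r) ^ 2 = 8 / Real.pi * r ^ 2 := by
    rw [mul_pow, mul_pow, Real.sq_sqrt Real.pi_pos.le]
    field_simp
    ring
  rw [e] at this
  have e2 : 8 / Real.pi * r ^ 2 = 2 * (4 / Real.pi * r ^ 2) := by ring
  linarith

lemma disk_subset_disk (x : S2) {r s : ℝ} (h : r ≤ s) : disk x r ⊆ disk x s :=
  fun _ hy => le_trans (show gdist x _ ≤ r from hy) h

/-- Areas of disks grow at most quadratically, up to the factor `5`, which is the rounded ratio
`π ^ 2 / 2` of the bounds in `area_disk_le` and `le_area_disk`.  The latter requires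
`ρ ≤ √π / 4`; larger disks contain a hemisphere. -/
lemma area_disk_le_mul (x y : S2) {ρ s : ℝ} (hρ : 0 < ρ) (hs : 2 * ρ ≤ s) :
    area (disk x s) ≤ ENNReal.ofReal (5 * (s / ρ) ^ 2) * area (disk y ρ) := by
  rcases le_total ρ (√Real.pi / 4) with h1 | h1
  · calc area (disk x s) ≤ ENNReal.ofReal (2 * Real.pi * s ^ 2) := area_disk_le x (by linarith)
      _ ≤ ENNReal.ofReal (5 * (s / ρ) ^ 2) * ENNReal.ofReal (4 / Real.pi * ρ ^ 2) := by
        rw [← ENNReal.ofReal_mul (by positivity)]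
        refine ENNReal.ofReal_le_ofReal ?_
        have e : 5 * (s / ρ) ^ 2 * (4 / Real.pi * ρ ^ 2) = 20 / Real.pi * s ^ 2 := by
          field_simp
          ring
        rw [e]
        refine mul_le_mul_of_nonneg_right ?_ (sq_nonneg s)
        rw [le_div_iff₀ Real.pi_pos]
        nlinarith [Real.pi_lt_d2, Real.pi_pos]
      _ ≤ _ := by
        gcongr
        exact le_area_disk y hρ.le h1
  · calc area (disk x s) ≤ 1 := prob_le_one
      _ ≤ ENNReal.ofReal (5 * (s / ρ) ^ 2) * ENNReal.ofReal (1 / 2) := by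
        rw [← ENNReal.ofReal_mul (by positivity), ENNReal.one_le_ofReal]
        have : 2 ≤ s / ρ := by rwa [le_div_iff₀ hρ]
        nlinarith
      _ ≤ ENNReal.ofReal (5 * (s / ρ) ^ 2) * area (disk y (√Real.pi / 4)) := by
        gcongr
        rw [area_disk y (by positivity) le_rfl, show 2 * √Real.pi * (√Real.pi / 4) = Real.pi / 2 by
          linear_combination sqrt_pi_sq / 2, Real.cos_pi_div_two, sub_zero]
      _ ≤ _ := by
        gcongr
        exact disk_subset_disk y h1

/-! ### Cells of the tessellation -/

lemma area_inter_voronoiCell {m : ℕ} {p : Fin m → S2} (hp : Function.Injective p)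
    {c c' : Fin m} (hne : c ≠ c') : area (voronoiCell p c ∩ voronoiCell p c') = 0 := by
  have hv : (p c : EuclideanSpace ℝ (Fin 3)) - p c' ≠ 0 :=
    sub_ne_zero.2 fun h => hne (hp (Subtype.ext h))
  refine measure_mono_null ?_ (area_orthogonal hv)
  rintro x ⟨h1, h2⟩
  have h : gdist (p c) x = gdist (p c') x := by
    rw [gdist_comm, gdist_comm (p c')]
    exact le_antisymm (h1 c') (h2 c)
  change inner ℝ ((p c : EuclideanSpace ℝ (Fin 3)) - p c') x = 0
  rw [inner_sub_left, inner_eq_cos_gdist, inner_eq_cos_gdist, h, sub_self]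

/-- Disks contained in different cells have centres at a distance of at least their radius:
otherwise the cells would have an overlap of positive area. -/
lemma le_gdist_of_disk_subset {m : ℕ} {p : Fin m → S2} (hp : Function.Injective p)
    {c c' : Fin m} (hne : c ≠ c') {x y : S2} {ρ : ℝ} (hρ : 0 < ρ)
    (hx : disk x ρ ⊆ voronoiCell p c) (hy : disk y ρ ⊆ voronoiCell p c') :
    ρ ≤ gdist x y := by
  by_contra! h
  have hU : IsOpen {z | gdist x z < ρ ∧ gdist y z < ρ} :=
    (isOpen_lt (continuous_const.gdist continuous_id) continuous_const).inter
      (isOpen_lt (continuous_const.gdist continuous_id) continuous_const)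
  refine (area_pos_of_isOpen hU ⟨y, h, by rwa [gdist_self]⟩).ne' ?_
  refine measure_mono_null ?_ (area_inter_voronoiCell hp hne)
  exact fun z hz => ⟨hx hz.1.le, hy hz.2.le⟩

namespace IsUniformTessellation

variable {m : ℕ} {p : Fin m → S2} {ρ : ℝ}

lemma gdist_le (hp : IsUniformTessellation p ρ) {c : Fin m} {x y : S2}
    (hx : x ∈ voronoiCell p c) (hy : y ∈ voronoiCell p c) : gdist x y ≤ 4 * ρ := by
  obtain ⟨z, hz⟩ := hp.subset_disk c
  have h1 : gdist z x ≤ 2 * ρ := hz hx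
  have h2 : gdist z y ≤ 2 * ρ := hz hy
  linarith [gdist_triangle x z y, gdist_comm x z]

/-- As the cells are disjoint up to null sets, there are at most `1 / a` of them if each contains
a disk of area `a`. -/
lemma card_mul_area_le (hp : IsUniformTessellation p ρ) {a : ℝ≥0∞}
    (ha : ∀ z, area (disk z ρ) = a) : (m : ℝ≥0∞) * a ≤ 1 := by
  have h : ∀ c, a ≤ area (voronoiCell p c) := by
    intro c
    obtain ⟨z, hz⟩ := hp.contains_disk c
    rw [← ha z]
    exact measure_mono hz
  calc (m : ℝ≥0∞) * a = ∑ _c : Fin m, a := by simp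
    _ ≤ ∑ c : Fin m, area (voronoiCell p c) := Finset.sum_le_sum fun c _ => h c
    _ = area (⋃ c, voronoiCell p c) := by
      rw [measure_iUnion₀ (fun c c' hne => area_inter_voronoiCell hp.injective hne)
        fun c => (isClosed_voronoiCell p c).measurableSet.nullMeasurableSet, tsum_fintype]
    _ ≤ 1 := prob_le_one

end IsUniformTessellation

/-! ### Counting hops -/

lemma card_le_of_window {ι : Type*} (S : Finset ι) (u : ι → ℝ) {L δ : ℝ} (B : ℕ) (hδ : 0 < δ)
    (hL : 0 ≤ L) (hu : ∀ j ∈ S, 0 ≤ u j ∧ u j ≤ L)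
    (hB : ∀ T ⊆ S, (∀ j ∈ T, ∀ j' ∈ T, |u j - u j'| ≤ δ) → T.card ≤ B) :
    (S.card : ℝ) ≤ B * (L / δ + 1) := by
  classical
  have h := Finset.card_le_mul_card_image_of_maps_to (s := S)
    (f := fun j => ⌊u j / δ⌋₊) (t := Finset.range (⌊L / δ⌋₊ + 1)) (fun j hj => by
      rw [Finset.mem_range, Nat.lt_succ_iff]
      exact Nat.floor_le_floor (div_le_div_of_nonneg_right (hu j hj).2 hδ.le)) B (by
      intro k _
      refine hB _ (Finset.filter_subset _ _) fun j hj j' hj' => ?_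
      rw [Finset.mem_filter] at hj hj'
      have e1 := Nat.floor_le (div_nonneg (hu j hj.1).1 hδ.le)
      have e2 := Nat.lt_floor_add_one (u j / δ)
      have e3 := Nat.floor_le (div_nonneg (hu j' hj'.1).1 hδ.le)
      have e4 := Nat.lt_floor_add_one (u j' / δ)
      rw [hj.2] at e1 e2
      rw [hj'.2] at e3 e4
      rw [le_div_iff₀ hδ] at e1 e3
      rw [div_lt_iff₀ hδ] at e2 e4
      rw [abs_le]
      constructor <;> nlinarith)
  rw [Finset.card_range] at h
  calc (S.card : ℝ) ≤ B * (⌊L / δ⌋₊ + 1 : ℕ) := by exact_mod_cast h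
    _ ≤ _ := by
      push_cast
      gcongr
      exact Nat.floor_le (by positivity)

lemma gdist_le_sum (f : ℕ → S2) (k : ℕ) :
    gdist (f 0) (f k) ≤ ∑ j ∈ Finset.range k, gdist (f j) (f (j + 1)) := by
  induction k with
  | zero => simp [gdist_self]
  | succ k ih =>
    rw [Finset.sum_range_succ]
    linarith [gdist_triangle (f 0) (f k) (f (k + 1))]

lemma receivedPower_anti {P α D : ℝ} (hα : 0 < α) {x y : S2} (h : gdist x y ≤ D) :
    ENNReal.ofReal P * ENNReal.ofReal D ^ (-α) ≤ receivedPower P α x y := by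
  unfold receivedPower
  rw [ENNReal.rpow_neg, ENNReal.rpow_neg]
  gcongr

namespace Operation

variable {n m : ℕ} {op : Operation n m} {p : Fin m → S2} {x : Fin n → S2} {d : Fin n → Fin n}
  {ρ P N α : ℝ} {i : Fin n} {t : ℕ}

/-- An interferer within distance `D` of the receiver of a hop of length more than `r` keeps the
SINR below `(D / r) ^ α`. -/
lemma sinr_lt (hα : 0 < α) (hP : 0 < P) {j : ℕ} {k : Fin n} {D r : ℝ} (hD : 0 < D) (hr : 0 < r)
    (hk : k ∈ op.transmitting (op.slot i t j)) (hne : k ≠ op.relay i t j)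
    (hkD : gdist (x k) (x (op.relay i t (j + 1))) ≤ D)
    (hlong : r < gdist (x (op.relay i t j)) (x (op.relay i t (j + 1)))) :
    op.sinr P N α x i t j < ENNReal.ofReal ((D / r) ^ α) := by
  classical
  set R := gdist (x (op.relay i t j)) (x (op.relay i t (j + 1))) with hR
  have hR0 : 0 < R := hr.trans hlong
  calc op.sinr P N α x i t j
      ≤ (ENNReal.ofReal P * ENNReal.ofReal R ^ (-α)) /
        (ENNReal.ofReal P * ENNReal.ofReal D ^ (-α)) := by
        unfold sinr
        refine ENNReal.div_le_div le_rfl ((receivedPower_anti hα hkD).trans ?_)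
        refine le_trans ?_ le_add_self
        exact Finset.single_le_sum
          (f := fun k => receivedPower P α (x k) (x (op.relay i t (j + 1))))
          (fun _ _ => zero_le) (by simpa using ⟨hk, hne⟩)
    _ = ENNReal.ofReal ((D / R) ^ α) := by
        rw [ENNReal.ofReal_rpow_of_pos hR0, ENNReal.ofReal_rpow_of_pos hD,
          ← ENNReal.ofReal_mul hP.le, ← ENNReal.ofReal_mul hP.le,
          ← ENNReal.ofReal_div_of_pos (by positivity), Real.div_rpow hD.le hR0.le,
          Real.rpow_neg hD.le, Real.rpow_neg hR0.le]
        congr 1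
        have := Real.rpow_pos_of_pos hD α
        have := Real.rpow_pos_of_pos hR0 α
        field_simp
    _ < _ := by
        rw [ENNReal.ofReal_lt_ofReal_iff (by positivity)]
        exact Real.rpow_lt_rpow (by positivity) (by gcongr) hα

/-- A line of length `L` meets at most `N₁ (L / ρ + 1)` cells in a sequence of distinct cells, for
each piece of length `ρ` of the line is met by at most `N₁` of them. -/
lemma card_cells_on_line_le (hp : IsUniformTessellation p ρ) (hρ : 0 < ρ) {N₁ : ℕ}
    (hN₁ : IsPackingBound N₁)
    {k : ℕ} {x y : S2} (hxy : (y : EuclideanSpace ℝ (Fin 3)) ≠ -x) {c : ℕ → Fin m} {w : ℕ → S2}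
    (hc : InjOn c (Iio k)) (hw : ∀ j < k, w j ∈ line x y)
    (hwc : ∀ j < k, w j ∈ voronoiCell p (c j)) :
    (k : ℝ) ≤ N₁ * (gdist x y / ρ + 1) := by
  choose z hz using hp.contains_disk
  have hzc : ∀ a, z a ∈ voronoiCell p a := fun a => hz a (by simpa [disk, gdist_self] using hρ.le)
  have h := card_le_of_window (Finset.range k) (fun j => gdist x (w j)) N₁ hρ (gdist_nonneg x y)
    (fun j hj => ⟨gdist_nonneg _ _, by
      have : gdist x (w j) + gdist (w j) y = gdist x y := hw j (Finset.mem_range.1 hj)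
      linarith [gdist_nonneg (w j) y]⟩) ?_
  · simpa using h
  intro T hT hTδ
  refine hN₁ ρ ℕ T (fun j => z (c j)) hρ (fun a ha b hb hab => ?_) (fun a ha b hb => ?_)
  · have ha' := Finset.mem_range.1 (hT ha)
    have hb' := Finset.mem_range.1 (hT hb)
    exact le_gdist_of_disk_subset hp.injective (fun h => hab (hc ha' hb' h)) hρ (hz _) (hz _)
  · have ha' := Finset.mem_range.1 (hT ha)
    have hb' := Finset.mem_range.1 (hT hb)
    have h1 := hTδ a ha b hb
    rw [← gdist_eq_abs_sub_of_mem_line hxy (hw a ha') (hw b hb')] at h1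
    have h2 := hp.gdist_le (hzc (c a)) (hwc a ha')
    have h3 := hp.gdist_le (hwc b hb') (hzc (c b))
    linarith [gdist_triangle (z (c a)) (w a) (z (c b)), gdist_triangle (w a) (w b) (z (c b))]

/-- On a connection that is long compared with `ρ`, at least `L / (16 ρ)` hops are longer than
`t₀ ρ` and suffer an interferer within distance `(M₀ + 8) ρ` of the receiver. -/
lemma le_ncard_low_sinr {K : ℕ} (hK : 0 < K) (hα : 0 < α) (hP : 0 < P) (hρ : 0 < ρ)
    (hp : IsUniformTessellation p ρ) {N₁ : ℕ} (hN₁0 : 0 < N₁) (hN₁ : IsPackingBound N₁)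
    {M₀ : ℝ} (hM₀ : 64 * K ≤ M₀)
    (hgen : ∀ k c c', c ≠ c' → x k ∈ voronoiCell p c → x k ∉ voronoiCell p c')
    (hanti : (x (d i) : EuclideanSpace ℝ (Fin 3)) ≠ -x i)
    (hS : op.IsSchedule K p x) (hR : op.IsStraightLine p x d) (hF : op.IsForwarding)
    (hL : 64 * (K + 1) * ρ ≤ gdist (x i) (x (d i))) (ht : t ∈ op.injects i) :
    gdist (x i) (x (d i)) / (16 * ρ) ≤
      ({j | j < op.hops i ∧ op.sinr P N α x i t j <
        ENNReal.ofReal (((M₀ + 8) / (1 / (8 * N₁))) ^ α)}.ncard : ℝ) := by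
  classical
  have hKr : (1 : ℝ) ≤ K := by exact_mod_cast hK
  have hN₁r : (0 : ℝ) < N₁ := by exact_mod_cast hN₁0
  have hM₀0 : 0 < M₀ := by linarith
  obtain ⟨w, hw0, hwl, hwline, -, hwcell⟩ := hR.in_order i
  obtain ⟨q, hq0, hqK, hper⟩ := hS.periodic
  set L := gdist (x i) (x (d i)) with hLdef
  set h := op.hops i with hh
  set t₀ : ℝ := 1 / (8 * N₁) with ht₀
  have ht₀0 : 0 < t₀ := by positivity
  have hinj : InjOn (op.cell i) (Iio h) := by
    rcases hR.once i with h1 | h1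
    · exact h1.mono Iio_subset_Iic_self
    · intro a ha b hb _
      rw [mem_Iio, hh, h1] at ha hb
      omega
  have hwu : ∀ j < h, gdist (x i) (w (j + 1)) ≤ L := by
    intro j hj
    have : gdist (x i) (w (j + 1)) + gdist (w (j + 1)) (x (d i)) = L := hwline (j + 1) (by omega)
    linarith [gdist_nonneg (w (j + 1)) (x (d i))]
  have hcount : (h : ℝ) ≤ N₁ * (L / ρ + 1) :=
    card_cells_on_line_le hp hρ hN₁ hanti hinj (w := fun j => w (j + 1))
      (fun j hj => hwline (j + 1) (by omega))
      fun j hj => (hwcell j hj.le).2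
  set len : ℕ → ℝ := fun j => gdist (x (op.relay i t j)) (x (op.relay i t (j + 1))) with hlen
  -- both cells of a hop have diameter at most `4 ρ` and contain `w (j + 1)`
  have hlen8 : ∀ j < h, len j ≤ 8 * ρ := by
    intro j hj
    have h1 := hp.gdist_le (hR.relay_mem i t ht j hj.le) (hwcell j hj.le).2
    have h2 := hp.gdist_le (hwcell (j + 1) hj).1 (hR.relay_mem i t ht (j + 1) hj)
    have := gdist_triangle (x (op.relay i t j)) (w (j + 1)) (x (op.relay i t (j + 1)))
    simp only [hlen]
    linarith
  have hsum : L ≤ ∑ j ∈ Finset.range h, len j := by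
    have := gdist_le_sum (fun j => x (op.relay i t j)) h
    simp only [hR.relay_zero i t ht, hh, hR.relay_last i t ht] at this
    exact this
  -- two hops are companions if they lie in the same stretch of the line and are served in the
  -- same slot of the cycle
  let comp : ℕ → ℕ → Prop := fun j j' => j' < h ∧ j' ≠ j ∧
    |gdist (x i) (w (j + 1)) - gdist (x i) (w (j' + 1))| ≤ M₀ * ρ ∧
    op.slot i t j % q = op.slot i t j' % q
  set alone := (Finset.range h).filter fun j => ¬ ∃ j', comp j j' with halone
  set good := (Finset.range h).filter fun j => (∃ j', comp j j') ∧ t₀ * ρ < len j with hgood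
  have halonecard : (alone.card : ℝ) ≤ K * (L / (M₀ * ρ) + 1) := by
    refine card_le_of_window alone (fun j => gdist (x i) (w (j + 1))) K (by positivity)
      (gdist_nonneg _ _) (fun j hj => ⟨gdist_nonneg _ _, hwu j ?_⟩) fun T hT hTδ => ?_
    · exact Finset.mem_range.1 (Finset.mem_filter.1 hj).1
    · refine le_trans ?_ hqK
      rw [← Finset.card_range q]
      refine Finset.card_le_card_of_injOn (fun j => op.slot i t j % q)
        (fun j _ => by simpa using Nat.mod_lt _ hq0) fun j hj j' hj' hjj' => ?_
      by_contra hne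
      have hj1 := Finset.mem_filter.1 (hT hj)
      have hj2 := Finset.mem_filter.1 (hT hj')
      exact hj1.2 ⟨j', Finset.mem_range.1 hj2.1, fun e => hne e.symm, hTδ j hj j' hj', hjj'⟩
  have hgoodsub : (good : Set ℕ) ⊆ {j | j < h ∧ op.sinr P N α x i t j <
        ENNReal.ofReal (((M₀ + 8) / t₀) ^ α)} := by
    intro j hj
    obtain ⟨hjh, ⟨j', hj'h, hne, hdist, hmod⟩, hlong⟩ := Finset.mem_filter.1 hj
    have hjh := Finset.mem_range.1 hjh
    refine ⟨hjh, ?_⟩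
    have hact : op.cell i j' ∈ op.active (op.slot i t j) := by
      rw [← hper.map_mod_nat, hmod, hper.map_mod_nat]
      exact hF.active i t ht j' hj'h
    set k := op.transmitter (op.slot i t j) (op.cell i j')
    have hkmem : x k ∈ voronoiCell p (op.cell i j') := hS.transmitter_mem _ _ hact
    have hkne : k ≠ op.relay i t j := by
      intro e
      refine hgen k _ _ (fun e' => hne (hinj hj'h hjh e')) hkmem ?_
      rw [e]
      exact hR.relay_mem i t ht j hjh.le
    have e : (M₀ + 8) / t₀ = (M₀ + 8) * ρ / (t₀ * ρ) := by field_simp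
    rw [e]
    refine sinr_lt hα hP (by positivity) (by positivity) ⟨_, hact, rfl⟩ hkne ?_ hlong
    have h1 := hp.gdist_le hkmem (hwcell j' hj'h.le).2
    have h2 := hp.gdist_le (hwcell (j + 1) hjh).1 (hR.relay_mem i t ht (j + 1) hjh)
    rw [← gdist_eq_abs_sub_of_mem_line hanti (hwline (j + 1) (by omega))
      (hwline (j' + 1) (by omega)), gdist_comm] at hdist
    linarith [gdist_triangle (x k) (w (j' + 1)) (x (op.relay i t (j + 1))),
      gdist_triangle (w (j' + 1)) (w (j + 1)) (x (op.relay i t (j + 1)))]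
  have hbound : ∑ j ∈ Finset.range h, len j ≤
      t₀ * ρ * h + 8 * ρ * alone.card + 8 * ρ * good.card := by
    have hpt : ∀ j ∈ Finset.range h, len j ≤ t₀ * ρ +
        8 * ρ * (if ¬ ∃ j', comp j j' then 1 else 0) +
        8 * ρ * (if (∃ j', comp j j') ∧ t₀ * ρ < len j then 1 else 0) := by
      intro j hj
      have h8 := hlen8 j (Finset.mem_range.1 hj)
      have h0 : 0 < t₀ * ρ := by positivity
      by_cases h1 : ∃ j', comp j j'
      · by_cases h2 : t₀ * ρ < len j
        · simp only [h1, h2, not_true, if_false, and_self, if_true]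
          linarith
        · simp only [h1, h2, not_true, if_false, and_false]
          linarith
      · simp only [h1, not_false_eq_true, if_true, false_and, if_false]
        linarith
    refine (Finset.sum_le_sum hpt).trans (le_of_eq ?_)
    rw [Finset.sum_add_distrib, Finset.sum_add_distrib, Finset.sum_const, Finset.card_range,
      nsmul_eq_mul, ← Finset.mul_sum, ← Finset.mul_sum, Finset.sum_boole, Finset.sum_boole]
    ring
  have hfin : {j | j < h ∧ op.sinr P N α x i t j <
      ENNReal.ofReal (((M₀ + 8) / t₀) ^ α)}.Finite := (finite_lt_nat h).subset fun j hj => hj.1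
  have hle : (good.card : ℝ) ≤ ({j | j < h ∧ op.sinr P N α x i t j <
      ENNReal.ofReal (((M₀ + 8) / t₀) ^ α)}.ncard : ℝ) := by
    rw [← ncard_coe_finset]
    exact_mod_cast ncard_le_ncard hgoodsub hfin
  refine le_trans ?_ hle
  set l := L / ρ with hl
  have hl64 : 64 * (K + 1) ≤ l := by rwa [hl, le_div_iff₀ hρ]
  have hLl : L = l * ρ := by rw [hl]; field_simp
  have e1 : L / (16 * ρ) = l / 16 := by rw [hLl]; field_simp
  have e2 : L / (M₀ * ρ) = l / M₀ := by rw [hLl]; field_simp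
  rw [e1]
  rw [e2] at halonecard
  have hKM : K * (l / M₀) ≤ l / 64 := by
    rw [mul_div_assoc', div_le_div_iff₀ hM₀0 (by norm_num)]
    nlinarith
  have ht₀h : t₀ * h ≤ (l + 1) / 8 := by
    calc t₀ * h ≤ t₀ * (N₁ * (l + 1)) := by gcongr
      _ = (l + 1) / 8 := by rw [ht₀]; field_simp
  have hdiv : l ≤ t₀ * h + 8 * alone.card + 8 * good.card := by
    refine le_of_mul_le_mul_right ?_ hρ
    rw [← hLl]
    linarith
  linarith

end Operation

/-! ### Throughput for given positions and destinations -/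

lemma successProb_le_one {φ : ℝ → ℝ} (hφ : IsSuccessCurve φ) (s : ℝ≥0∞) :
    successProb φ s ≤ 1 := by
  unfold successProb
  split_ifs
  · exact le_rfl
  · exact ENNReal.ofReal_le_one.2 (hφ.lt_one _ ENNReal.toReal_nonneg).le

lemma successProb_le {φ : ℝ → ℝ} (hφ : IsSuccessCurve φ) {s : ℝ≥0∞} {β : ℝ} (hβ : 0 ≤ β)
    (hs : s < ENNReal.ofReal β) : successProb φ s ≤ ENNReal.ofReal (φ β) := by
  unfold successProb
  rw [if_neg (hs.trans ENNReal.ofReal_lt_top).ne]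
  refine ENNReal.ofReal_le_ofReal (hφ.monotoneOn ENNReal.toReal_nonneg hβ ?_)
  exact ENNReal.toReal_le_of_le_ofReal hβ hs.le

namespace Operation

variable {n m : ℕ} {op : Operation n m} {φ : ℝ → ℝ} {p : Fin m → S2} {x : Fin n → S2}
  {d : Fin n → Fin n} {ρ P N α : ℝ} {i : Fin n}

lemma deliveryProb_le_one (hφ : IsSuccessCurve φ) (t : ℕ) :
    op.deliveryProb φ P N α x i t ≤ 1 :=
  Finset.prod_le_one' fun _ _ => successProb_le_one hφ _

lemma deliveryProb_le_pow (hφ : IsSuccessCurve φ) {β : ℝ} (hβ : 0 ≤ β) (t : ℕ) :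
    op.deliveryProb φ P N α x i t ≤ ENNReal.ofReal (φ β) ^
      {j | j < op.hops i ∧ op.sinr P N α x i t j < ENNReal.ofReal β}.ncard := by
  classical
  have hset : {j | j < op.hops i ∧ op.sinr P N α x i t j < ENNReal.ofReal β} =
      ((Finset.range (op.hops i)).filter fun j => op.sinr P N α x i t j < ENNReal.ofReal β :
        Finset ℕ) := by
    ext j
    simp
  rw [hset, ncard_coe_finset, deliveryProb, ← Finset.prod_const, Finset.prod_filter]
  refine Finset.prod_le_prod' fun j _ => ?_
  split_ifs with h
  · exact successProb_le hφ hβ h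
  · exact successProb_le_one hφ _

lemma throughput_le_one (hφ : IsSuccessCurve φ) : op.throughput φ P N α x i ≤ 1 := by
  classical
  refine limsup_le_of_le (by isBoundedDefault) (Eventually.of_forall fun T => ?_)
  refine ENNReal.div_le_of_le_mul ?_
  rw [one_mul]
  calc _ ≤ ∑ t ∈ (Finset.range T).filter (· ∈ op.injects i), (1 : ℝ≥0∞) :=
        Finset.sum_le_sum fun t _ => deliveryProb_le_one hφ t
    _ ≤ T := by
      rw [Finset.sum_const, nsmul_one]
      exact_mod_cast (Finset.card_filter_le _ _).trans (Finset.card_range T).le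

lemma throughput_le_mul {r : ℝ} (hr : op.HasRate r) {b : ℝ≥0∞} (hb : b ≠ ∞)
    (h : ∀ t ∈ op.injects i, op.deliveryProb φ P N α x i t ≤ b) :
    op.throughput φ P N α x i ≤ b * ENNReal.ofReal r := by
  classical
  have hlim := ENNReal.Tendsto.const_mul (ENNReal.tendsto_ofReal (hr i)) (Or.inr hb)
  rw [← hlim.limsup_eq]
  refine limsup_le_limsup (Eventually.of_forall fun T => ?_) (by isBoundedDefault)
    (by isBoundedDefault)
  rcases Nat.eq_zero_or_pos T with rfl | hT
  · simp
  have hT' : (0 : ℝ) < T := by exact_mod_cast hT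
  beta_reduce
  rw [ENNReal.ofReal_div_of_pos hT', ENNReal.ofReal_natCast, ENNReal.ofReal_natCast,
    ← mul_div_assoc]
  refine ENNReal.div_le_div_right ?_ _
  calc _ ≤ ∑ t ∈ (Finset.range T).filter (· ∈ op.injects i), b :=
        Finset.sum_le_sum fun t ht => h t (Finset.mem_filter.1 ht).2
    _ = _ := by
      rw [Finset.sum_const, nsmul_eq_mul, mul_comm]

/-- In each slot every cell injects at most one packet, so that the rates of all nodes together
are at most the number of cells. -/
lemma mul_rate_le (hR : op.IsStraightLine p x d) (hF : op.IsForwarding)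
    {r : ℝ} (hr : op.HasRate r) : n * r ≤ m := by
  classical
  have hlim : Tendsto (fun T : ℕ => ∑ i : Fin n,
      (((Finset.range T).filter (· ∈ op.injects i)).card : ℝ) / T) atTop (𝓝 (∑ _i : Fin n, r)) :=
    tendsto_finsetSum _ fun i _ => by
      convert! hr i
  rw [Finset.sum_const, Finset.card_univ, Fintype.card_fin, nsmul_eq_mul] at hlim
  refine le_of_tendsto' hlim fun T => ?_
  have hslot : ∀ t, (Finset.univ.filter fun i : Fin n => t ∈ op.injects i).card ≤ m := by
    intro t
    refine le_of_le_of_eq ?_ (Finset.card_fin m)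
    refine Finset.card_le_card_of_injOn (fun i => op.cell i 0) (fun _ _ => Finset.mem_univ _) ?_
    intro i hi i' hi' hii
    have ht := (Finset.mem_filter.1 hi).2
    have ht' := (Finset.mem_filter.1 hi').2
    have e := hF.transmitter i t ht 0 (hR.hops_pos i)
    have e' := hF.transmitter i' t ht' 0 (hR.hops_pos i')
    rw [hF.slot_zero i t ht, hR.relay_zero i t ht] at e
    rw [hF.slot_zero i' t ht', hR.relay_zero i' t ht'] at e'
    rw [← e, ← e']
    exact congrArg _ hii
  rw [← Finset.sum_div]
  refine div_le_of_le_mul₀ (Nat.cast_nonneg _) (Nat.cast_nonneg _) ?_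
  have hcomm : ∑ i : Fin n, ((Finset.range T).filter (· ∈ op.injects i)).card =
      ∑ t ∈ Finset.range T, (Finset.univ.filter fun i : Fin n => t ∈ op.injects i).card := by
    simp only [Finset.card_filter]
    exact Finset.sum_comm
  have : ∑ i : Fin n, ((Finset.range T).filter (· ∈ op.injects i)).card ≤ m * T := by
    rw [hcomm]
    refine (Finset.sum_le_sum fun t _ => hslot t).trans ?_
    rw [Finset.sum_const, Finset.card_range, smul_eq_mul, mul_comm]
  exact_mod_cast this

end Operation

/-! ### Random positions and destinations -/

namespace IsRandomNetwork

variable {Ω : Type*} [MeasurableSpace Ω] {μ : Measure Ω} {n : ℕ}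
  {X : Fin n → Ω → S2} {D : Fin n → Ω → Fin n}

lemma measure_preimage (h : IsRandomNetwork μ X D) (i : Fin n) {s : Set S2}
    (hs : MeasurableSet s) : μ (X i ⁻¹' s) = area s := by
  rw [← h.law_position i, Measure.map_apply (h.measurable_position i) hs]

lemma sum_measure_destination (h : IsRandomNetwork μ X D) (i : Fin n) (hn : 2 ≤ n) :
    ∑ j ∈ Finset.univ.erase i, μ {ω | D i ω = j} = 1 := by
  rw [Finset.sum_congr rfl fun j hj => h.law_destination i j (Finset.ne_of_mem_erase hj),
    Finset.sum_const, Finset.card_erase_of_mem (Finset.mem_univ i), Finset.card_fin, nsmul_eq_mul]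
  refine ENNReal.mul_inv_cancel ?_ (ENNReal.natCast_ne_top _)
  simp only [ne_eq, Nat.cast_eq_zero]
  omega

lemma measure_pair_le [IsProbabilityMeasure μ] (h : IsRandomNetwork μ X D) {i j : Fin n}
    (hij : i ≠ j) {B : Set (S2 × S2)}
    (hB : MeasurableSet B) {b : ℝ≥0∞} (hb : ∀ x, area (Prod.mk x ⁻¹' B) ≤ b) :
    μ {ω | (X i ω, X j ω) ∈ B} ≤ b := by
  have hi := h.measurable_position i
  have hj := h.measurable_position j
  have hmap := (indepFun_iff_map_prod_eq_prod_map_map hi.aemeasurable hj.aemeasurable).1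
    (h.indep_position.indepFun hij)
  rw [h.law_position, h.law_position] at hmap
  have : {ω | (X i ω, X j ω) ∈ B} = (fun ω => (X i ω, X j ω)) ⁻¹' B := rfl
  rw [this, ← Measure.map_apply (hi.prodMk hj) hB, hmap, Measure.prod_apply hB]
  calc _ ≤ ∫⁻ _, b ∂area := lintegral_mono hb
    _ = b := by simp

lemma measure_destination_self [IsProbabilityMeasure μ] (h : IsRandomNetwork μ X D) (i : Fin n)
    (hn : 2 ≤ n) :
    μ {ω | D i ω = i} = 0 := by
  have hsum : ∑ j, μ {ω | D i ω = j} = 1 := by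
    have := sum_measure_preimage_singleton (μ := μ) (f := D i) Finset.univ
      fun j _ => h.measurable_destination i (measurableSet_singleton j)
    simp only [Finset.coe_univ, preimage_univ, measure_univ] at this
    exact this
  rw [← Finset.add_sum_erase _ _ (Finset.mem_univ i), h.sum_measure_destination i hn] at hsum
  have h1 : μ {ω | D i ω = i} + 1 = 0 + 1 := by rw [hsum, zero_add]
  exact (ENNReal.add_left_inj ENNReal.one_ne_top).1 h1

/-- A source and its destination are distributed like two independent uniform points. -/
lemma measure_connection_le [IsProbabilityMeasure μ] (h : IsRandomNetwork μ X D) (i : Fin n)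
    (hn : 2 ≤ n) {B : Set (S2 × S2)} (hB : MeasurableSet B) {b : ℝ≥0∞}
    (hb : ∀ x, area (Prod.mk x ⁻¹' B) ≤ b) :
    μ {ω | (X i ω, X (D i ω) ω) ∈ B} ≤ b := by
  have hsub : {ω | (X i ω, X (D i ω) ω) ∈ B} ⊆ {ω | D i ω = i} ∪
      ⋃ j ∈ Finset.univ.erase i, ({ω | (X i ω, X j ω) ∈ B} ∩ {ω | D i ω = j}) := by
    intro ω hω
    by_cases hd : D i ω = i
    · exact Or.inl hd
    · refine Or.inr (mem_biUnion (x := D i ω) ?_ ⟨hω, rfl⟩)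
      simpa using hd
  have hind : ∀ j, μ ({ω | (X i ω, X j ω) ∈ B} ∩ {ω | D i ω = j}) =
      μ {ω | (X i ω, X j ω) ∈ B} * μ {ω | D i ω = j} := by
    intro j
    exact h.indep.measure_inter_preimage_eq_mul {x | (x i, x j) ∈ B} {d | d i = j}
      (hB.preimage ((measurable_pi_apply i).prodMk (measurable_pi_apply j)))
      ((measurableSet_singleton j).preimage (measurable_pi_apply i))
  calc _ ≤ μ {ω | D i ω = i} + ∑ j ∈ Finset.univ.erase i,
        μ ({ω | (X i ω, X j ω) ∈ B} ∩ {ω | D i ω = j}) :=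
        (measure_mono hsub).trans ((measure_union_le _ _).trans
          (add_le_add_right (measure_biUnion_finset_le _ _) _))
    _ = ∑ j ∈ Finset.univ.erase i, μ {ω | (X i ω, X j ω) ∈ B} * μ {ω | D i ω = j} := by
      rw [h.measure_destination_self i hn, zero_add]
      exact Finset.sum_congr rfl fun j _ => hind j
    _ ≤ ∑ j ∈ Finset.univ.erase i, b * μ {ω | D i ω = j} := by
      refine Finset.sum_le_sum fun j hj => ?_
      gcongr
      exact h.measure_pair_le (Finset.ne_of_mem_erase hj).symm hB hb
    _ = b := by rw [← Finset.mul_sum, h.sum_measure_destination i hn, mul_one]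

lemma measure_length_le [IsProbabilityMeasure μ] (h : IsRandomNetwork μ X D) (i : Fin n)
    (hn : 2 ≤ n) {s : ℝ} {b : ℝ≥0∞}
    (hb : ∀ x, area (disk x s) ≤ b) : μ {ω | gdist (X i ω) (X (D i ω) ω) ≤ s} ≤ b :=
  h.measure_connection_le i hn (B := {q | gdist q.1 q.2 ≤ s})
    (isClosed_le (continuous_fst.gdist continuous_snd) continuous_const).measurableSet hb

lemma ae_ne_antipode [IsProbabilityMeasure μ] (h : IsRandomNetwork μ X D) (i : Fin n) (hn : 2 ≤ n) :
    ∀ᵐ ω ∂μ, (X (D i ω) ω : EuclideanSpace ℝ (Fin 3)) ≠ -X i ω := by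
  rw [ae_iff]
  simp only [ne_eq, not_not]
  refine le_antisymm (h.measure_connection_le i hn
    (B := {q | (q.2 : EuclideanSpace ℝ (Fin 3)) = -q.1})
    (isClosed_eq (by fun_prop) (by fun_prop)).measurableSet fun x => ?_) zero_le
  have hz : -(x : EuclideanSpace ℝ (Fin 3)) ∈ Metric.sphere (0 : EuclideanSpace ℝ (Fin 3)) 1 := by
    simp
  refine (measure_mono (t := disk ⟨_, hz⟩ 0) fun y hy => ?_).trans
    ((area_disk_le _ le_rfl).trans (by simp))
  have : y = ⟨_, hz⟩ := Subtype.ext hy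
  rw [← this]
  exact (gdist_self y).le

lemma ae_mem_single_cell (h : IsRandomNetwork μ X D) {m : ℕ} {p : Fin m → S2}
    (hp : Function.Injective p) :
    ∀ᵐ ω ∂μ, ∀ k c c', c ≠ c' → X k ω ∈ voronoiCell p c → X k ω ∉ voronoiCell p c' := by
  simp only [ae_all_iff]
  intro k c c' hne
  rw [ae_iff]
  refine measure_mono_null (t := X k ⁻¹' (voronoiCell p c ∩ voronoiCell p c')) ?_ ?_
  · intro ω hω
    simp only [Set.mem_ofPred_eq, Classical.not_imp, not_not] at hω
    exact hω
  · rw [h.measure_preimage k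
      ((isClosed_voronoiCell p c).inter (isClosed_voronoiCell p c')).measurableSet,
      area_inter_voronoiCell hp hne]

lemma measurable_length (h : IsRandomNetwork μ X D) (i : Fin n) :
    Measurable fun ω => gdist (X i ω) (X (D i ω) ω) := by
  have hd : Measurable fun ω => X (D i ω) ω := by
    intro s hs
    have : (fun ω => X (D i ω) ω) ⁻¹' s = ⋃ j, (D i ⁻¹' {j} ∩ X j ⁻¹' s) := by
      ext ω
      simp
    rw [this]
    exact MeasurableSet.iUnion fun j =>
      (h.measurable_destination i (measurableSet_singleton j)).inter (h.measurable_position j hs)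
  have hg : Measurable fun q : S2 × S2 => gdist q.1 q.2 := by
    have hc : Continuous fun q : S2 × S2 => gdist q.1 q.2 := continuous_fst.gdist continuous_snd
    exact hc.measurable
  have hpair := (h.measurable_position i).prodMk hd
  have hcomp := Measurable.comp hg hpair
  exact hcomp

/-- A cell of area `a` contains none of the nodes with probability at most `exp (-n a)`. -/
lemma measure_empty_le (h : IsRandomNetwork μ X D) {s : Set S2} (hs : MeasurableSet s) {a : ℝ}
    (ha : ENNReal.ofReal a ≤ area s) :
    μ {ω | ∀ k, X k ω ∉ s} ≤ ENNReal.ofReal (Real.exp (-(n * a))) := by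
  have hset : {ω | ∀ k, X k ω ∉ s} = ⋂ k ∈ Finset.univ, X k ⁻¹' sᶜ := by
    ext ω
    simp
  rw [hset, h.indep_position.measure_inter_preimage_eq_mul Finset.univ fun k _ => hs.compl,
    Finset.prod_congr rfl fun k _ => h.measure_preimage k hs.compl, Finset.prod_const,
    Finset.card_fin, prob_compl_eq_one_sub hs, ← mul_neg, Real.exp_nat_mul,
    ENNReal.ofReal_pow (Real.exp_pos _).le]
  refine pow_le_pow_left₀ zero_le ?_ n
  rcases le_total a 0 with h0 | h0
  · refine tsub_le_self.trans ?_
    rw [ENNReal.one_le_ofReal]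
    exact Real.one_le_exp (by linarith)
  · refine (tsub_le_tsub_left ha 1).trans ?_
    rw [← ENNReal.ofReal_one, ← ENNReal.ofReal_sub _ h0]
    refine ENNReal.ofReal_le_ofReal ?_
    linarith [Real.add_one_le_exp (-a)]

end IsRandomNetwork

/-- If the distribution function of `Y ≥ 0` is at most `A s ^ 2`, then the Laplace transform of
`Y` at `b` is at most `∫ b exp (-b s) A s ^ 2 ds = 2 A / b ^ 2`. -/
lemma lintegral_exp_neg_mul_le {Ω : Type*} [MeasurableSpace Ω] {μ : Measure Ω} [SFinite μ]
    {Y : Ω → ℝ} (hY : Measurable Y) (hY0 : ∀ ω, 0 ≤ Y ω) {A b : ℝ} (hA : 0 ≤ A) (hb : 0 < b)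
    (hdist : ∀ s, 0 ≤ s → μ {ω | Y ω ≤ s} ≤ ENNReal.ofReal (A * s ^ 2)) :
    ∫⁻ ω, ENNReal.ofReal (Real.exp (-b * Y ω)) ∂μ ≤ ENNReal.ofReal (2 * A / b ^ 2) := by
  have hexp : ∀ y : ℝ, ENNReal.ofReal (Real.exp (-b * y)) =
      ∫⁻ s in Ioi y, ENNReal.ofReal (b * Real.exp (-b * s)) := by
    intro y
    rw [← ofReal_integral_eq_lintegral_ofReal, integral_const_mul,
      integral_exp_mul_Ioi (by linarith)]
    · congr 1
      field_simp
    · exact (integrableOn_exp_mul_Ioi (by linarith) y).const_mul b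
    · exact ae_of_all _ fun s => by positivity
  have h1 : ∀ ω, ENNReal.ofReal (Real.exp (-b * Y ω)) =
      ∫⁻ s in Ioi 0, {q : Ω × ℝ | Y q.1 < q.2}.indicator
        (fun q => ENNReal.ofReal (b * Real.exp (-b * q.2))) (ω, s) := by
    intro ω
    rw [hexp, ← inter_eq_self_of_subset_left (Ioi_subset_Ioi (hY0 ω)),
      ← Measure.restrict_restrict measurableSet_Ioi, ← lintegral_indicator measurableSet_Ioi]
    rfl
  have hm : MeasurableSet {q : Ω × ℝ | Y q.1 < q.2} :=
    measurableSet_lt (hY.comp measurable_fst) measurable_snd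
  simp_rw [h1]
  rw [lintegral_lintegral_swap (by
    refine Measurable.aemeasurable ?_
    exact Measurable.indicator (by fun_prop) hm)]
  have h2 : ∀ s ∈ Ioi (0 : ℝ), ∫⁻ ω, {q : Ω × ℝ | Y q.1 < q.2}.indicator
        (fun q => ENNReal.ofReal (b * Real.exp (-b * q.2))) (ω, s) ∂μ ≤
      ENNReal.ofReal (b * A * (s ^ ((3 : ℝ) - 1) * Real.exp (-(b * s)))) := by
    intro s hs
    have e : ∀ ω, {q : Ω × ℝ | Y q.1 < q.2}.indicator
        (fun q => ENNReal.ofReal (b * Real.exp (-b * q.2))) (ω, s) =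
        {ω | Y ω < s}.indicator (fun _ => ENNReal.ofReal (b * Real.exp (-b * s))) ω := fun ω => rfl
    simp_rw [e]
    rw [lintegral_indicator_const (measurableSet_lt hY measurable_const)]
    calc _ ≤ ENNReal.ofReal (b * Real.exp (-b * s)) * ENNReal.ofReal (A * s ^ 2) := by
          gcongr
          exact (measure_mono fun ω (hω : Y ω < s) => hω.le).trans (hdist s (le_of_lt hs))
      _ = _ := by
        rw [← ENNReal.ofReal_mul (by positivity)]
        congr 1
        rw [show (3 : ℝ) - 1 = (2 : ℕ) by norm_num, Real.rpow_natCast, neg_mul]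
        ring
  refine (setLIntegral_mono' measurableSet_Ioi h2).trans (le_of_eq ?_)
  have hint := Real.integral_rpow_mul_exp_neg_mul_Ioi (a := 3) (r := b) (by norm_num) hb
  rw [← ofReal_integral_eq_lintegral_ofReal, integral_const_mul, hint]
  · congr 1
    have : Real.Gamma 3 = 2 := by
      rw [show (3 : ℝ) = (2 : ℕ) + 1 by norm_num, Real.Gamma_nat_eq_factorial]
      norm_num [Nat.factorial]
    rw [this, show (3 : ℝ) = (3 : ℕ) by norm_num, Real.rpow_natCast]
    field_simp
  · refine Integrable.const_mul (not_imp_comm.1 integral_undef ?_) _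
    rw [hint]
    have := Real.Gamma_pos_of_pos (show (0 : ℝ) < 3 by norm_num)
    positivity
  · refine (ae_restrict_iff' measurableSet_Ioi).2 (ae_of_all _ fun s hs => ?_)
    have : (0 : ℝ) < s := hs
    positivity

/-! ### The number of cells and the rate -/

/-- A network needs at least two nodes for `100 log n / n` to be a positive area. -/
lemma two_le_of_area_disk {n : ℕ} {ρ : ℝ} (hρ : 0 < ρ)
    (ha : ∀ z, area (disk z ρ) = ENNReal.ofReal (100 * Real.log n / n)) (x : S2) : 2 ≤ n := by
  have hpos : 0 < area (disk x ρ) := by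
    have hU : IsOpen {z | gdist x z < ρ} :=
      isOpen_lt (continuous_const.gdist continuous_id) continuous_const
    exact (area_pos_of_isOpen hU ⟨x, show gdist x x < ρ by rwa [gdist_self]⟩).trans_le
      (measure_mono fun z (hz : gdist x z < ρ) => hz.le)
  rw [ha] at hpos
  by_contra! h
  interval_cases n <;> simp at hpos

lemma one_le_hundred_log {n : ℕ} (hn : 2 ≤ n) : 1 ≤ 100 * Real.log n := by
  have h2 : Real.log 2 ≤ Real.log n := Real.log_le_log (by norm_num) (by exact_mod_cast hn)
  linarith [Real.log_two_gt_d9]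

lemma card_cells_mul_le {n m : ℕ} {p : Fin m → S2} {ρ : ℝ} (hn : 2 ≤ n)
    (hp : IsUniformTessellation p ρ)
    (ha : ∀ z, area (disk z ρ) = ENNReal.ofReal (100 * Real.log n / n)) :
    m * (100 * Real.log n / n) ≤ 1 := by
  have h := hp.card_mul_area_le ha
  have hl := one_le_hundred_log hn
  rw [← ENNReal.ofReal_natCast, ← ENNReal.ofReal_mul (by positivity)] at h
  exact ENNReal.ofReal_le_one.1 h

lemma IsRandomNetwork.measure_exists_empty_le {Ω : Type*} [MeasurableSpace Ω] {μ : Measure Ω}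
    {n m : ℕ} {X : Fin n → Ω → S2} {D : Fin n → Ω → Fin n} (h : IsRandomNetwork μ X D)
    {p : Fin m → S2} {ρ : ℝ} (hn : 2 ≤ n) (hp : IsUniformTessellation p ρ)
    (ha : ∀ z, area (disk z ρ) = ENNReal.ofReal (100 * Real.log n / n)) :
    μ {ω | ¬ ∀ c, ∃ k, X k ω ∈ voronoiCell p c} ≤ ENNReal.ofReal (1 / n) := by
  have hn0 : (0 : ℝ) < n := by positivity
  have hn1 : (1 : ℝ) ≤ n := by exact_mod_cast (by omega : 1 ≤ n)
  have hset : {ω | ¬ ∀ c, ∃ k, X k ω ∈ voronoiCell p c} =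
      ⋃ c, {ω | ∀ k, X k ω ∉ voronoiCell p c} := by
    ext ω
    simp
  have hmn : (m : ℝ) ≤ n := by
    have h1 := card_cells_mul_le hn hp ha
    rw [mul_div_assoc', div_le_one hn0] at h1
    nlinarith [one_le_hundred_log hn, (Nat.cast_nonneg m : (0 : ℝ) ≤ m)]
  have hexp : Real.exp (-(n * (100 * Real.log n / n))) = ((n : ℝ) ^ 100)⁻¹ := by
    rw [mul_div_cancel₀ _ hn0.ne', Real.exp_neg, mul_comm, Real.exp_mul, Real.exp_log hn0]
    norm_cast
  calc _ ≤ ∑ c, μ {ω | ∀ k, X k ω ∉ voronoiCell p c} := by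
        rw [hset]
        exact measure_iUnion_fintype_le _ _
    _ ≤ ∑ _c : Fin m, ENNReal.ofReal (((n : ℝ) ^ 100)⁻¹) := by
      refine Finset.sum_le_sum fun c _ => ?_
      obtain ⟨z, hz⟩ := hp.contains_disk c
      rw [← hexp]
      exact h.measure_empty_le (isClosed_voronoiCell p c).measurableSet
        ((ha z).symm.le.trans (measure_mono hz))
    _ = ENNReal.ofReal (m * ((n : ℝ) ^ 100)⁻¹) := by
      rw [Finset.sum_const, Finset.card_fin, nsmul_eq_mul, ENNReal.ofReal_mul (by positivity),
        ENNReal.ofReal_natCast]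
    _ ≤ _ := by
      refine ENNReal.ofReal_le_ofReal ?_
      rw [← div_eq_mul_inv, div_le_div_iff₀ (by positivity) hn0, one_mul]
      calc (m : ℝ) * n ≤ n * n := by gcongr
        _ = (n : ℝ) ^ 2 := by ring
        _ ≤ (n : ℝ) ^ 100 := pow_le_pow_right₀ hn1 (by norm_num)

/-! ### Expected throughput -/

/-- If each packet has at least `l` hops with SINR below `β`, the throughput is at most `φ β ^ l`
times the rate. -/
lemma Operation.throughput_le_exp {n m : ℕ} {op : Operation n m} {φ : ℝ → ℝ} {x : Fin n → S2}
    {P N α β r l : ℝ} {i : Fin n} (hφ : IsSuccessCurve φ) (hβ : 0 ≤ β) (hq : 0 < φ β)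
    (hr : op.HasRate r)
    (hl : ∀ t ∈ op.injects i, l ≤
      ({j | j < op.hops i ∧ op.sinr P N α x i t j < ENNReal.ofReal β}.ncard : ℝ)) :
    op.throughput φ P N α x i ≤
      ENNReal.ofReal (Real.exp (l * Real.log (φ β))) * ENNReal.ofReal r := by
  refine throughput_le_mul hr ENNReal.ofReal_ne_top fun t ht =>
    (deliveryProb_le_pow hφ hβ t).trans ?_
  rw [← ENNReal.ofReal_pow hq.le, ← Real.exp_log (pow_pos hq _), Real.log_pow]
  refine ENNReal.ofReal_le_ofReal (Real.exp_le_exp.2 ?_)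
  exact mul_le_mul_of_nonpos_right (hl t ht) (Real.log_nonpos hq.le (hφ.lt_one _ hβ).le)

/-- Expected throughput: the probability of an empty cell is at most `1 / n`; otherwise the rate
is at most `m / n`, and it is reduced by `exp (-b L)` for connections of length `L ≥ C ρ`. -/
lemma lintegral_throughput_le {Ω : Type*} [MeasurableSpace Ω] {μ : Measure Ω}
    [IsProbabilityMeasure μ] {n m : ℕ} {X : Fin n → Ω → S2} {D : Fin n → Ω → Fin n}
    (h : IsRandomNetwork μ X D) {p : Fin m → S2} {ρ C b : ℝ} (hn : 2 ≤ n) (hρ : 0 < ρ)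
    (hC : 2 ≤ C) (hb : 0 < b) (hp : IsUniformTessellation p ρ)
    (ha : ∀ z, area (disk z ρ) = ENNReal.ofReal (100 * Real.log n / n)) {i : Fin n}
    {f : Ω → ℝ≥0∞} (hf1 : ∀ ω, f ω ≤ 1)
    (hf : ∀ᵐ ω ∂μ, (∀ c, ∃ k, X k ω ∈ voronoiCell p c) →
      f ω ≤ ENNReal.ofReal (m / n) ∧
      (C * ρ ≤ gdist (X i ω) (X (D i ω) ω) →
        f ω ≤ ENNReal.ofReal (Real.exp (-b * gdist (X i ω) (X (D i ω) ω))) *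
          ENNReal.ofReal (m / n))) :
    ∫⁻ ω, f ω ∂μ ≤ ENNReal.ofReal ((1 + 10 / (b * ρ) ^ 2 + 5 * C ^ 2) / n) := by
  classical
  set a : ℝ := 100 * Real.log n / n with hadef
  have hn0 : (0 : ℝ) < n := by positivity
  have ha0 : 0 ≤ a := by
    have := one_le_hundred_log hn
    positivity
  set len : Ω → ℝ := fun ω => gdist (X i ω) (X (D i ω) ω)
  have hlenm : Measurable len := h.measurable_length i
  have htail : ∀ s, C * ρ ≤ s → μ {ω | len ω ≤ s} ≤ ENNReal.ofReal (5 * a / ρ ^ 2 * s ^ 2) := by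
    intro s hs
    refine h.measure_length_le i hn fun x => ?_
    have hs2 : 2 * ρ ≤ s := (mul_le_mul_of_nonneg_right hC hρ.le).trans hs
    refine (area_disk_le_mul x x hρ hs2).trans (le_of_eq ?_)
    rw [ha, ← ENNReal.ofReal_mul (by positivity)]
    congr 1
    field_simp
  -- lengths below `C ρ` are raised to `C ρ`, as the quadratic bound fails for small disks
  have hY : ∫⁻ ω, ENNReal.ofReal (Real.exp (-b * max (len ω) (C * ρ))) ∂μ ≤
      ENNReal.ofReal (2 * (5 * a / ρ ^ 2) / b ^ 2) := by
    refine lintegral_exp_neg_mul_le (hlenm.max measurable_const)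
      (fun ω => le_max_of_le_left (gdist_nonneg _ _)) (by positivity) hb fun s _ => ?_
    by_cases hs : C * ρ ≤ s
    · exact (measure_mono fun ω (hω : max (len ω) (C * ρ) ≤ s) =>
        (le_max_left _ _).trans hω).trans (htail s hs)
    · have : {ω | max (len ω) (C * ρ) ≤ s} = ∅ := by
        ext ω
        simp only [Set.mem_ofPred_eq, mem_empty_iff_false, iff_false, max_le_iff, not_and]
        exact fun _ => hs
      rw [this, measure_empty]
      exact zero_le
  set E := {ω | ¬ ∀ c, ∃ k, X k ω ∈ voronoiCell p c} with hE
  have hEm : MeasurableSet E := by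
    have : E = ⋃ c, ⋂ k, X k ⁻¹' (voronoiCell p c)ᶜ := by
      ext ω
      simp [hE]
    rw [this]
    exact MeasurableSet.iUnion fun c => MeasurableSet.iInter fun k =>
      h.measurable_position k (isClosed_voronoiCell p c).measurableSet.compl
  have hSm : MeasurableSet {ω | len ω ≤ C * ρ} := measurableSet_le hlenm measurable_const
  have hpt : ∀ᵐ ω ∂μ, f ω ≤ E.indicator 1 ω + ENNReal.ofReal (m / n) *
      (ENNReal.ofReal (Real.exp (-b * max (len ω) (C * ρ))) +
        {ω | len ω ≤ C * ρ}.indicator 1 ω) := by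
    filter_upwards [hf] with ω hω
    by_cases hωE : ω ∈ E
    · rw [indicator_of_mem hωE]
      exact (hf1 ω).trans le_self_add
    · obtain ⟨h1, h2⟩ := hω (not_not.1 hωE)
      rw [indicator_of_notMem hωE, zero_add]
      by_cases hL : C * ρ ≤ len ω
      · rw [max_eq_left hL, mul_comm]
        refine (h2 hL).trans ?_
        gcongr
        exact le_self_add
      · have hmem : ω ∈ {ω | len ω ≤ C * ρ} := (not_le.1 hL).le
        rw [indicator_of_mem hmem]
        calc f ω ≤ ENNReal.ofReal (m / n) * 1 := by rwa [mul_one]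
          _ ≤ _ := by
            gcongr
            exact le_add_self
  have hYm : Measurable fun ω => ENNReal.ofReal (Real.exp (-b * max (len ω) (C * ρ))) :=
    ((((hlenm.max measurable_const).const_mul (-b))).exp).ennreal_ofReal
  calc ∫⁻ ω, f ω ∂μ ≤ ∫⁻ ω, (E.indicator 1 ω + ENNReal.ofReal (m / n) *
      (ENNReal.ofReal (Real.exp (-b * max (len ω) (C * ρ))) +
        {ω | len ω ≤ C * ρ}.indicator 1 ω)) ∂μ := lintegral_mono_ae hpt
    _ = μ E + ENNReal.ofReal (m / n) *
        (∫⁻ ω, ENNReal.ofReal (Real.exp (-b * max (len ω) (C * ρ))) ∂μ +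
          μ {ω | len ω ≤ C * ρ}) := by
      rw [lintegral_add_left (measurable_one.indicator hEm), lintegral_indicator_one hEm,
        lintegral_const_mul' _ _ ENNReal.ofReal_ne_top, lintegral_add_left hYm,
        lintegral_indicator_one hSm]
    _ ≤ ENNReal.ofReal (1 / n) + ENNReal.ofReal (m / n) *
        (ENNReal.ofReal (2 * (5 * a / ρ ^ 2) / b ^ 2) +
          ENNReal.ofReal (5 * a / ρ ^ 2 * (C * ρ) ^ 2)) := by
      gcongr
      · exact h.measure_exists_empty_le hn hp ha
      · exact htail _ le_rfl
    _ ≤ _ := by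
      have hma : m * a ≤ 1 := card_cells_mul_le hn hp ha
      rw [← ENNReal.ofReal_add (by positivity) (by positivity),
        ← ENNReal.ofReal_mul (by positivity), ← ENNReal.ofReal_add (by positivity) (by positivity)]
      refine ENNReal.ofReal_le_ofReal ?_
      have e : 1 / (n : ℝ) + m / n * (2 * (5 * a / ρ ^ 2) / b ^ 2 + 5 * a / ρ ^ 2 * (C * ρ) ^ 2) =
          (1 + m * a * (10 / (b * ρ) ^ 2 + 5 * C ^ 2)) / n := by
        field_simp
        ring
      rw [e]
      refine div_le_div_of_nonneg_right ?_ hn0.le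
      have : 0 ≤ 10 / (b * ρ) ^ 2 + 5 * C ^ 2 := by positivity
      nlinarith

/-- The constant `M₀` can be chosen so large that the success probability at
`((M₀ + 8) / t₀) ^ α` is positive with a logarithm as small as desired. -/
lemma exists_success_near_one {φ : ℝ → ℝ} (hφ : IsSuccessCurve φ) {α t₀ : ℝ} (hα : 0 < α)
    (ht₀ : 0 < t₀) (B A : ℝ) :
    ∃ M₀ : ℝ, B ≤ M₀ ∧ 9 < M₀ ∧ 0 < φ (((M₀ + 8) / t₀) ^ α) ∧
      Real.log (φ (((M₀ + 8) / t₀) ^ α)) ^ 2 * A ≤ 1 := by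
  have h1 : Tendsto (fun M : ℝ => φ (((M + 8) / t₀) ^ α)) atTop (𝓝 1) :=
    hφ.tendsto_one.comp ((tendsto_rpow_atTop hα).comp
      ((tendsto_atTop_add_const_right _ 8 tendsto_id).atTop_div_const ht₀))
  have h2 : Tendsto (fun M : ℝ => Real.log (φ (((M + 8) / t₀) ^ α)) ^ 2 * A) atTop (𝓝 0) := by
    have := ((h1.log one_ne_zero).pow 2).mul_const A
    simpa using this
  obtain ⟨M, hM⟩ := ((h1.eventually (lt_mem_nhds one_pos)).and
    ((h2.eventually (gt_mem_nhds one_pos)).and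
      ((eventually_ge_atTop B).and (eventually_gt_atTop 9)))).exists
  exact ⟨M, hM.2.2.1, hM.2.2.2, hM.1, hM.2.1.le⟩

end AdHoc

theorem proposition2
    (K : ℕ) (hK : 0 < K) (α : ℝ) (hα : 2 < α) (φ : ℝ → ℝ) (hφ : AdHoc.IsSuccessCurve φ) :
    ∃ t₀ M₀ C β₀ : ℝ, 0 < t₀ ∧ t₀ < 1 ∧ 9 < M₀ ∧ β₀ = ((M₀ + 8) / t₀) ^ α ∧ 0 < φ β₀ ∧
      ∀ (n m : ℕ) (ρ P N : ℝ) (p : Fin m → AdHoc.S2)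
        (_ : 0 < ρ) (_ : 0 < P) (_ : 0 ≤ N)
        (_ : ∀ z, AdHoc.area (AdHoc.disk z ρ) = ENNReal.ofReal (100 * Real.log n / n))
        (_ : AdHoc.IsUniformTessellation p ρ)
        (Ω : Type*) (_ : MeasurableSpace Ω) (μ : Measure Ω) (_ : IsProbabilityMeasure μ)
        (X : Fin n → Ω → AdHoc.S2) (D : Fin n → Ω → Fin n)
        (_ : AdHoc.IsRandomNetwork μ X D)
        (op : Ω → AdHoc.Operation n m)
        -- the scheme is required to work whenever every cell contains a node
        (_ : ∀ᵐ ω ∂μ, (∀ c, ∃ i, X i ω ∈ AdHoc.voronoiCell p c) →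
          (op ω).IsSchedule K p (fun k => X k ω) ∧
          (op ω).IsStraightLine p (fun k => X k ω) (fun k => D k ω) ∧
          (op ω).IsForwarding ∧
          ∃ r, (op ω).HasRate r)
        (i : Fin n),
        -- `β₀` bounds the SINR on at least `L / (16 ρ)` hops of a connection of length `L`
        (∀ᵐ ω ∂μ, (∀ c, ∃ k, X k ω ∈ AdHoc.voronoiCell p c) →
          C * ρ ≤ AdHoc.gdist (X i ω) (X (D i ω) ω) →
          ∀ t ∈ (op ω).injects i,
            AdHoc.gdist (X i ω) (X (D i ω) ω) / (16 * ρ) ≤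
              ({j | j < (op ω).hops i ∧
                (op ω).sinr P N α (fun k => X k ω) i t j < ENNReal.ofReal β₀}.ncard : ℝ)) ∧
        -- the expected throughput of every connection
        ∫⁻ ω, (op ω).throughput φ P N α (fun k => X k ω) i ∂μ ≤
          ENNReal.ofReal (2 ^ 12 / Real.log (φ β₀) ^ 2 / n) := by
  obtain ⟨N₁, hN₁0, hN₁⟩ := AdHoc.exists_packing_bound
  have hN₁r : (1 : ℝ) ≤ N₁ := by exact_mod_cast hN₁0
  have hKr : (1 : ℝ) ≤ K := by exact_mod_cast hK
  have hα0 : 0 < α := by linarith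
  -- with `t₀ = 1 / (8 N₁)` the short hops make up about an eighth of the line at most; `C` must
  -- not depend on `M₀`, as `M₀` is chosen such that `φ β₀` is close to one in terms of `C`
  have ht₀ : (0 : ℝ) < 1 / (8 * N₁) := by positivity
  obtain ⟨M₀, hM₀K, hM₀9, hq, hlog⟩ := AdHoc.exists_success_near_one hφ hα0 ht₀ (64 * K)
    (1 + 5 * (64 * (K + 1)) ^ 2)
  refine ⟨1 / (8 * N₁), M₀, 64 * (K + 1), ((M₀ + 8) / (1 / (8 * N₁))) ^ α, ht₀, ?_, hM₀9, rfl, hq,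
    ?_⟩
  · rw [div_lt_one (by positivity)]
    linarith
  set β₀ := ((M₀ + 8) / (1 / (8 * N₁))) ^ α with hβ₀
  have hβ₀0 : 0 ≤ β₀ := by positivity
  intro n m ρ P N p hρ hP _ ha hp Ω _ μ _ X D hXD op hop i
  have : Nonempty Ω := nonempty_of_isProbabilityMeasure μ
  have hn : 2 ≤ n := AdHoc.two_le_of_area_disk hρ ha (X i (Classical.arbitrary Ω))
  have hn0 : (0 : ℝ) < n := by positivity
  have hbad : ∀ᵐ ω ∂μ, (∀ c, ∃ k, X k ω ∈ AdHoc.voronoiCell p c) →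
      64 * (K + 1) * ρ ≤ AdHoc.gdist (X i ω) (X (D i ω) ω) → ∀ t ∈ (op ω).injects i,
        AdHoc.gdist (X i ω) (X (D i ω) ω) / (16 * ρ) ≤
          ({j | j < (op ω).hops i ∧
            (op ω).sinr P N α (fun k => X k ω) i t j < ENNReal.ofReal β₀}.ncard : ℝ) := by
    filter_upwards [hop, hXD.ae_ne_antipode i hn, hXD.ae_mem_single_cell hp.injective]
      with ω hω hanti hgen hocc hL t ht
    obtain ⟨hS, hR, hF, -⟩ := hω hocc
    exact AdHoc.Operation.le_ncard_low_sinr (op := op ω) (x := fun k => X k ω)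
      (d := fun k => D k ω) hK hα0 hP hρ hp hN₁0 hN₁ hM₀K hgen hanti hS hR hF hL ht
  refine ⟨hbad, ?_⟩
  have hlneg : Real.log (φ β₀) < 0 := Real.log_neg hq (hφ.lt_one _ hβ₀0)
  have hb : 0 < -Real.log (φ β₀) / (16 * ρ) := div_pos (by linarith) (by positivity)
  refine (AdHoc.lintegral_throughput_le hXD (i := i) hn hρ (C := 64 * (K + 1)) (by linarith)
    hb hp ha (fun ω => AdHoc.Operation.throughput_le_one hφ) ?_).trans ?_
  · filter_upwards [hop, hbad] with ω hω hbadω hocc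
    obtain ⟨-, hR, hF, r, hr⟩ := hω hocc
    have hrm : ENNReal.ofReal r ≤ ENNReal.ofReal (m / n) := by
      refine ENNReal.ofReal_le_ofReal ?_
      rw [le_div_iff₀ hn0, mul_comm]
      exact AdHoc.Operation.mul_rate_le (op := op ω) hR hF hr
    refine ⟨?_, fun hL => ?_⟩
    · refine (AdHoc.Operation.throughput_le_mul hr ENNReal.one_ne_top fun t _ =>
        AdHoc.Operation.deliveryProb_le_one hφ t).trans ?_
      rwa [one_mul]
    · refine (AdHoc.Operation.throughput_le_exp hφ hβ₀0 hq hr (hbadω hocc hL)).trans ?_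
      refine mul_le_mul' (le_of_eq ?_) hrm
      congr 2
      ring
  · refine ENNReal.ofReal_le_ofReal (div_le_div_of_nonneg_right ?_ hn0.le)
    have hlne := hlneg.ne
    have hl2 : 0 < Real.log (φ β₀) ^ 2 := by positivity
    have e : -Real.log (φ β₀) / (16 * ρ) * ρ = -Real.log (φ β₀) / 16 := by field_simp
    rw [e, le_div_iff₀ hl2]
    have e2 : (1 + 10 / (-Real.log (φ β₀) / 16) ^ 2 + 5 * (64 * ((K : ℝ) + 1)) ^ 2) *
        Real.log (φ β₀) ^ 2 =
        Real.log (φ β₀) ^ 2 * (1 + 5 * (64 * (K + 1)) ^ 2) + 2560 := by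
      field_simp
      ring
    rw [e2]
    linarith
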